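/- Let $\mathbb K$ be a field of characteristic different from $2$, and let $(\mathcal A,A,A')$ be a quasi-twilled associative algebra over $\mathbb K$: $\mathcal A$ is a (not necessarily unital) associative $\mathbb K$-algebra with a decomposition $\mathcal A=A\oplus A'$ into two subspaces such that $A'$ is a subalgebra. Write the multiplication of $\mathcal A$ as $\Omega=\pi+\xi+\eta+\beta+\rho+\mu+\theta$ with components $\pi:A\otimes A\to A$, $\xi:A\otimes A'\to A$, $\eta:A'\otimes A\to A$, $\beta:A'\otimes A'\to A'$, $\rho:A\otimes A'\to A'$, $\mu:A'\otimes A\to A'$, $\theta:A\otimes A\to A'$. A multilinear map $f$ between copies of $A$ and $A'$ is identified with its lift, the multilinear map on $\mathcal A$ with values in $\mathcal A$ that equals $f$ on the domain of $f$ and vanishes on all other tensor products of $A$ and $A'$. Recall that a curved V-data $(L,F,P,\Delta)$ consists of a graded Lie algebra $(L=\bigoplus_i L^i,[\cdot,\cdot])$, an abelian graded Lie subalgebra $F$, a linear map $P:L\to L$ with $P\circ P=P$ whose image is $F$ and whose kernel is a graded Lie subalgebra, and $\Delta\in L^1$ with $[\Delta,\Delta]=0$. A curved $L_\infty$-algebra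 is a $\mathbb Z$-graded vector space $\mathfrak g$ with linear maps $l_k:\otimes^k\mathfrak g\to\mathfrak g$ of degree $1$, $k\ge 0$, such that for all homogeneous $x_1,\dots,x_n$ one has $l_n(x_{\sigma(1)},\dots,x_{\sigma(n)})=\varepsilon(\sigma)\,l_n(x_1,\dots,x_n)$ for all $\sigma\in S_n$, and, for all $n\ge0$, $$\sum_{i=0}^n\ \sum_{\sigma\in S(i,n-i)}\varepsilon(\sigma)\,l_{n-i+1}\bigl(l_i(x_{\sigma(1)},\dots,x_{\sigma(i)}),x_{\sigma(i+1)},\dots,x_{\sigma(n)}\bigr)=0,$$ where $S(i,n-i)$ is the set of $(i,n-i)$-shuffles and $\varepsilon(\sigma)$ is the Koszul sign. A Maurer–Cartan element of it is an $x\in\mathfrak g^0$ such that only finitely many $l_k(x,\dots,x)$ are nonzero and $l_0+\sum_{k\ge1}\frac1{k!}l_k(x,\dots,x)=0$. Then the following $(L,F,P,\Delta)$ is a curved V-data: - $L=\bigoplus_{n\ge0}\mathrm{Hom}(\otimes^{n+1}\mathcal A,\mathcal A)$, with $\mathrm{Hom}(\otimes^{n+1}\mathcal A,\mathcal A)$ in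 degree $n$, with the Gerstenhaber bracket $[f,g]_G=f\circ g-(-1)^{(m-1)(n-1)}g\circ f$ for $f\in\mathrm{Hom}(\otimes^m\mathcal A,\mathcal A)$, $g\in\mathrm{Hom}(\otimes^n\mathcal A,\mathcal A)$, where $(f\circ g)(x_1,\dots,x_{m+n-1})=\sum_{i=1}^m(-1)^{(i-1)(n-1)}f(x_1,\dots,x_{i-1},g(x_i,\dots,x_{i+n-1}),x_{i+n},\dots,x_{m+n-1})$; - $F=\bigoplus_{n\ge0}\mathrm{Hom}(\otimes^{n+1}A,A')$, embedded in $L$ by the lift, which is injective; - $P:L\to L$ is the projection onto $F$ that restricts a cochain to $\otimes^{n+1}A$ and projects its values to $A'$ along $A$; - $\Delta=\Omega=\pi+\xi+\eta+\beta+\rho+\mu+\theta$. Consequently $F$, with the grading induced from $L$, is a curved $L_\infty$-algebra with the brackets $l_k(f_1,\dots,f_k)=P[\cdots[[\Delta,f_1]_G,f_2]_G,\cdots,f_k]_G$, $k\ge0$, and these are given, for $f,g\in F$, by $$l_0=\theta,\qquad l_1(f)=[\pi+\rho+\mu,f]_G,\qquad l_2(f,g)=[[\xi+\eta+\beta,f]_G,g]_G,\qquad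 l_k=0\quad(k\ge3).$$ Furthermore, a linear map $D:A\to A'$ is a right deformation map of $(\mathcal A,A,A')$, that is, $$D\bigl(\pi(x,y)+\xi(x,D(y))+\eta(D(x),y)\bigr)=\rho(x,D(y))+\mu(D(x),y)+\beta(D(x),D(y))+\theta(x,y)\quad\text{for all }x,y\in A,$$ if and only if $D$ is a Maurer–Cartan element of this curved $L_\infty$-algebra. -/

import Mathlib

open scoped DirectSum

noncomputable section

namespace QuasiTwilled

/-! ### Graded Lie algebras, curved V-data and curved `L∞`-algebras -/

section General

variable {K : Type*} [Field K] {L : Type*} [AddCommGroup L] [Module K L]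

/-- `L = ⨁ 𝒢 i` is a `ℤ`-graded Lie algebra under the bilinear bracket `br`. -/
structure IsGradedLieAlgebra (𝒢 : ℤ → Submodule K L) (br : L →ₗ[K] L →ₗ[K] L) : Prop where
  internal : DirectSum.IsInternal 𝒢
  degree : ∀ i j x y, x ∈ 𝒢 i → y ∈ 𝒢 j → br x y ∈ 𝒢 (i + j)
  skew : ∀ i j x y, x ∈ 𝒢 i → y ∈ 𝒢 j → br x y = -((i * j).negOnePow • br y x)
  jacobi : ∀ i j k x y z, x ∈ 𝒢 i → y ∈ 𝒢 j → z ∈ 𝒢 k →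
    br x (br y z) = br (br x y) z + (i * j).negOnePow • br y (br x z)

/-- `S` is a graded Lie subalgebra: it is spanned by its homogeneous elements and closed under
the bracket. -/
structure IsGradedLieSubalgebra (𝒢 : ℤ → Submodule K L) (br : L →ₗ[K] L →ₗ[K] L)
    (S : Submodule K L) : Prop where
  graded : S = ⨆ i, S ⊓ 𝒢 i
  closed : ∀ x ∈ S, ∀ y ∈ S, br x y ∈ S

/-- `(L, F, P, Δ)` is a curved V-data. -/
structure IsCurvedVData (𝒢 : ℤ → Submodule K L) (br : L →ₗ[K] L →ₗ[K] L)
    (F : Submodule K L) (P : L →ₗ[K] L) (Δ : L) : Prop where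
  gradedLie : IsGradedLieAlgebra 𝒢 br
  subalgebra : IsGradedLieSubalgebra 𝒢 br F
  abelian : ∀ x ∈ F, ∀ y ∈ F, br x y = 0
  proj : P ∘ₗ P = P
  range_proj : LinearMap.range P = F
  ker_proj : IsGradedLieSubalgebra 𝒢 br (LinearMap.ker P)
  degree_one : Δ ∈ 𝒢 1
  square_zero : br Δ Δ = 0

/-- The iterated bracket `(x₁, …, xₖ) ↦ [⋯[[Δ, x₁], x₂], ⋯, xₖ]`. -/
def iteratedBracket (br : L →ₗ[K] L →ₗ[K] L) (Δ : L) :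
    (k : ℕ) → MultilinearMap K (fun _ : Fin k => L) L
  | 0 => MultilinearMap.constOfIsEmpty K _ Δ
  | k + 1 => MultilinearMap.uncurryRight (M := fun _ : Fin (k + 1) => L)
      (br.compMultilinearMap (iteratedBracket br Δ k))

/-- The derived brackets `lₖ(x₁, …, xₖ) = P [⋯[[Δ, x₁], x₂], ⋯, xₖ]` on `F`; in particular
`l₀ = P Δ`. -/
def derivedBracket (br : L →ₗ[K] L →ₗ[K] L) (F : Submodule K L) (P : L →ₗ[K] L)
    (hP : ∀ x, P x ∈ F) (Δ : L) (k : ℕ) : MultilinearMap K (fun _ : Fin k => F) F :=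
  (P.codRestrict F hP).compMultilinearMap
    ((iteratedBracket br Δ k).compLinearMap fun _ => F.subtype)

/-- The grading that a subspace `F` inherits: `Fⁱ = F ∩ Lⁱ`. -/
def inducedGrading (𝒢 : ℤ → Submodule K L) (F : Submodule K L) (i : ℤ) : Submodule K F :=
  (𝒢 i).comap F.subtype

/-- The Koszul sign `ε(σ; x₁, …, xₙ)` for elements of degrees `d₁, …, dₙ`: the product of
`(-1)^{d_a d_b}` over all pairs whose order is reversed in `x_{σ(1)}, …, x_{σ(n)}`. -/
def koszulSign {n : ℕ} (d : Fin n → ℤ) (σ : Equiv.Perm (Fin n)) : ℤˣ :=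
  ∏ p : Fin n × Fin n with p.1 < p.2 ∧ σ p.2 < σ p.1, (d (σ p.1) * d (σ p.2)).negOnePow

/-- `σ` is an `(i, n - i)`-shuffle: `σ(1) < ⋯ < σ(i)` and `σ(i+1) < ⋯ < σ(n)`. -/
def IsShuffle {n : ℕ} (i : ℕ) (σ : Equiv.Perm (Fin n)) : Prop :=
  ∀ a b : Fin n, a < b → ((b : ℕ) < i ∨ i ≤ (a : ℕ)) → σ a < σ b

/-- `l_{n-i+1}(l_i(y₁, …, y_i), y_{i+1}, …, y_n)`. -/
def nestedTerm (l : (k : ℕ) → MultilinearMap K (fun _ : Fin k => L) L) {n : ℕ}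
    (i : Fin (n + 1)) (y : Fin n → L) : L :=
  l (n - i + 1) (Fin.cons (α := fun _ => L)
    (l i fun a : Fin i => y ⟨a, by omega⟩)
    fun b : Fin (n - i) => y ⟨i + b, by omega⟩)

open Classical in
/-- `(L, {lₖ}_{k ≥ 0})` is a curved `L∞`-algebra on the graded space `L = ⨁ 𝒢 i`. -/
structure IsCurvedLInfinity (𝒢 : ℤ → Submodule K L)
    (l : (k : ℕ) → MultilinearMap K (fun _ : Fin k => L) L) : Prop where
  internal : DirectSum.IsInternal 𝒢
  degree : ∀ (k : ℕ) (x : Fin k → L) (d : Fin k → ℤ), (∀ a, x a ∈ 𝒢 (d a)) →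
    l k x ∈ 𝒢 (∑ a, d a + 1)
  symm : ∀ (n : ℕ) (x : Fin n → L) (d : Fin n → ℤ), (∀ a, x a ∈ 𝒢 (d a)) →
    ∀ σ : Equiv.Perm (Fin n), l n (fun a => x (σ a)) = koszulSign d σ • l n x
  jacobi : ∀ (n : ℕ) (x : Fin n → L) (d : Fin n → ℤ), (∀ a, x a ∈ 𝒢 (d a)) →
    ∑ i : Fin (n + 1), ∑ σ : Equiv.Perm (Fin n) with IsShuffle i σ,
      koszulSign d σ • nestedTerm l i (fun a => x (σ a)) = 0

/-- `x` is a Maurer–Cartan element: it has degree `0`, only finitely many `lₖ(x, …, x)` are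
nonzero, and `l₀ + ∑_{k ≥ 1} (1 / k!) lₖ(x, …, x) = 0` (the summand `k = 0` below is `l₀`). -/
structure IsMaurerCartan (𝒢 : ℤ → Submodule K L)
    (l : (k : ℕ) → MultilinearMap K (fun _ : Fin k => L) L) (x : L) : Prop where
  degree_zero : x ∈ 𝒢 0
  finite : {k : ℕ | l k (fun _ => x) ≠ 0}.Finite
  sum_eq_zero : ∑ᶠ k : ℕ, ((k.factorial : K)⁻¹ • l k (fun _ => x)) = 0

end General

/-! ### Cochains and the Gerstenhaber bracket -/

section Gerstenhaber

variable (K : Type*) [Field K] (V W : Type*) [AddCommGroup V] [Module K V]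
  [AddCommGroup W] [Module K W]

/-- `Hom(⊗ⁿ⁺¹ V, W)`, placed in degree `n`. -/
abbrev Cochain (n : ℕ) : Type _ := MultilinearMap K (fun _ : Fin (n + 1) => V) W

/-- The graded vector space `⨁_{n ≥ 0} Hom(⊗ⁿ⁺¹ V, W)`. -/
abbrev Cochains : Type _ := ⨁ n : ℕ, Cochain K V W n

/-- The homogeneous part of degree `i ∈ ℤ`: `Hom(⊗ⁱ⁺¹ V, W)` if `i ≥ 0`, and `0` if `i < 0`. -/
def cochainGrading : ℤ → Submodule K (Cochains K V W)
  | Int.ofNat n => LinearMap.range (DirectSum.lof K ℕ (Cochain K V W) n)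
  | Int.negSucc _ => ⊥

variable {K V}

/-- The list `x₁, …, x_{i-1}, g(x_i, …, x_{i+n}), x_{i+n+1}, …` (with `i` counted from `0`). -/
def insertArgs {m n : ℕ} (g : Cochain K V V n) (i : Fin (m + 1)) (x : Fin (m + n + 1) → V) :
    Fin (m + 1) → V := fun j =>
  if j < i then x ⟨j, by omega⟩
  else if j = i then g fun k => x ⟨i + k, by omega⟩
  else x ⟨j + n, by omega⟩

theorem insertArgs_eq_update {m n : ℕ} (g : Cochain K V V n) (i : Fin (m + 1))
    (x : Fin (m + n + 1) → V) :
    insertArgs g i x =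
      Function.update (insertArgs (0 : Cochain K V V n) i x) i (g fun k => x ⟨i + k, by omega⟩) := by
  funext j
  by_cases h : j = i
  · subst h; simp [insertArgs]
  · simp [insertArgs, h]

theorem insertArgs_update_lt {m n : ℕ} (g : Cochain K V V n) (i : Fin (m + 1))
    (x : Fin (m + n + 1) → V) (p : Fin (m + n + 1)) (h : (p : ℕ) < i) (c : V) :
    insertArgs g i (Function.update x p c) =
      Function.update (insertArgs g i x) ⟨p, by omega⟩ c := by
  have hk : (fun k : Fin (n + 1) => Function.update x p c ⟨i + k, by omega⟩) =
      fun k : Fin (n + 1) => x ⟨i + k, by omega⟩ := by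
    funext k
    rw [Function.update_of_ne]
    intro e; have := congrArg Fin.val e; simp at this; omega
  funext j
  by_cases hj : j = i
  · subst hj
    rw [Function.update_of_ne (by rw [Ne, Fin.ext_iff]; simp; omega)]
    simp [insertArgs, hk]
  · simp only [insertArgs, Function.update_apply, Fin.ext_iff, Fin.lt_def]
    rw [Fin.ext_iff] at hj
    split_ifs <;> first | rfl | omega

theorem insertArgs_update_gt {m n : ℕ} (g : Cochain K V V n) (i : Fin (m + 1))
    (x : Fin (m + n + 1) → V) (p : Fin (m + n + 1)) (h : (i : ℕ) + n < p) (c : V) :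
    insertArgs g i (Function.update x p c) =
      Function.update (insertArgs g i x) ⟨p - n, by omega⟩ c := by
  have hk : (fun k : Fin (n + 1) => Function.update x p c ⟨i + k, by omega⟩) =
      fun k : Fin (n + 1) => x ⟨i + k, by omega⟩ := by
    funext k
    rw [Function.update_of_ne]
    intro e; have := congrArg Fin.val e; simp at this; omega
  funext j
  by_cases hj : j = i
  · subst hj
    rw [Function.update_of_ne (by rw [Ne, Fin.ext_iff]; simp; omega)]
    simp [insertArgs, hk]
  · simp only [insertArgs, Function.update_apply, Fin.ext_iff, Fin.lt_def]
    rw [Fin.ext_iff] at hj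
    split_ifs <;> first | rfl | omega

theorem insertArgs_update_mid {m n : ℕ} (g : Cochain K V V n) (i : Fin (m + 1))
    (x : Fin (m + n + 1) → V) (p : Fin (m + n + 1)) (h : (i : ℕ) ≤ p) (h' : (p : ℕ) ≤ i + n)
    (c : V) :
    insertArgs g i (Function.update x p c) =
      Function.update (insertArgs g i x) i
        (g (Function.update (fun k : Fin (n + 1) => x ⟨i + k, by omega⟩)
          ⟨p - i, by omega⟩ c)) := by
  have hk : (fun k : Fin (n + 1) => Function.update x p c ⟨i + k, by omega⟩) =
      Function.update (fun k : Fin (n + 1) => x ⟨i + k, by omega⟩) ⟨p - i, by omega⟩ c := by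
    funext k
    simp only [Function.update_apply, Fin.ext_iff]
    split_ifs <;> first | rfl | omega
  funext j
  by_cases hj : j = i
  · subst hj; simp [insertArgs, hk]
  · simp only [insertArgs, Function.update_apply, Fin.ext_iff, Fin.lt_def]
    rw [Fin.ext_iff] at hj
    split_ifs <;> first | rfl | omega

/-- The `i`-th partial composition
`f(x₁, …, x_{i-1}, g(x_i, …, x_{i+n}), x_{i+n+1}, …)` (with `i` counted from `0`). -/
def insertAt {m n : ℕ} (f : Cochain K V V m) (g : Cochain K V V n) (i : Fin (m + 1)) :
    Cochain K V V (m + n) :=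
  MultilinearMap.mk' (fun x => f (insertArgs g i x))
    (by
      intro x p a b
      rcases lt_or_ge (p : ℕ) i with h | h
      · simp only [insertArgs_update_lt g i x p h, MultilinearMap.map_update_add]
      · rcases le_or_gt (p : ℕ) (i + n) with h' | h'
        · simp only [insertArgs_update_mid g i x p h h', MultilinearMap.map_update_add]
        · simp only [insertArgs_update_gt g i x p h', MultilinearMap.map_update_add])
    (by
      intro x p c a
      rcases lt_or_ge (p : ℕ) i with h | h
      · simp only [insertArgs_update_lt g i x p h, MultilinearMap.map_update_smul]
      · rcases le_or_gt (p : ℕ) (i + n) with h' | h'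
        · simp only [insertArgs_update_mid g i x p h h', MultilinearMap.map_update_smul]
        · simp only [insertArgs_update_gt g i x p h', MultilinearMap.map_update_smul])

theorem insertAt_apply {m n : ℕ} (f : Cochain K V V m) (g : Cochain K V V n) (i : Fin (m + 1))
    (x : Fin (m + n + 1) → V) : insertAt f g i x = f (insertArgs g i x) := rfl

/-- `f ∘ g = ∑ᵢ (-1)^{i n} f(x₁, …, g(x_i, …), …)`, with `i` counted from `0`, for `f` of degree
`m` and `g` of degree `n` (that is, with `m + 1` and `n + 1` arguments), as a bilinear map. -/
def circ (m n : ℕ) :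
    Cochain K V V m →ₗ[K] Cochain K V V n →ₗ[K] Cochain K V V (m + n) :=
  LinearMap.mk₂ K (fun f g => ∑ i : Fin (m + 1), (-1 : K) ^ ((i : ℕ) * n) • insertAt f g i)
    (by
      intro f f' g
      rw [← Finset.sum_add_distrib]
      refine Finset.sum_congr rfl fun i _ => ?_
      rw [← smul_add]
      rfl)
    (by
      intro c f g
      rw [Finset.smul_sum]
      refine Finset.sum_congr rfl fun i _ => ?_
      rw [smul_comm]
      rfl)
    (by
      intro f g g'
      rw [← Finset.sum_add_distrib]
      refine Finset.sum_congr rfl fun i _ => ?_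
      rw [← smul_add]
      congr 1
      ext x
      simp only [insertAt_apply, add_apply]
      rw [insertArgs_eq_update (g + g'), insertArgs_eq_update g, insertArgs_eq_update g',
        add_apply, MultilinearMap.map_update_add])
    (by
      intro c f g
      rw [Finset.smul_sum]
      refine Finset.sum_congr rfl fun i _ => ?_
      rw [smul_comm]
      congr 1
      ext x
      simp only [insertAt_apply, smul_apply]
      rw [insertArgs_eq_update (c • g), insertArgs_eq_update g,
        smul_apply, MultilinearMap.map_update_smul])

variable (K V)

/-- The Gerstenhaber bracket `[f, g] = f ∘ g - (-1)^{m n} g ∘ f` for `f`, `g` of degrees `m`, `n`,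
with values in the total space. -/
def bracketHom (m n : ℕ) :
    Cochain K V V m →ₗ[K] Cochain K V V n →ₗ[K] Cochains K V V :=
  LinearMap.mk₂ K
    (fun f g => DirectSum.lof K ℕ (Cochain K V V) (m + n) (circ m n f g) -
      (-1 : K) ^ (m * n) • DirectSum.lof K ℕ (Cochain K V V) (n + m) (circ n m g f))
    (by intro f f' g; simp only [map_add, LinearMap.add_apply, smul_add]; abel)
    (by
      intro c f g
      simp only [map_smul, LinearMap.smul_apply, smul_sub]
      rw [smul_comm c])
    (by intro f g g'; simp only [map_add, LinearMap.add_apply, smul_add]; abel)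
    (by
      intro c f g
      simp only [map_smul, LinearMap.smul_apply, smul_sub]
      rw [smul_comm c])

/-- The Gerstenhaber bracket on `⨁_{n ≥ 0} Hom(⊗ⁿ⁺¹ V, V)`: the bilinear extension of
`bracketHom`. -/
def gerstenhaber : Cochains K V V →ₗ[K] Cochains K V V →ₗ[K] Cochains K V V :=
  DirectSum.toModule K ℕ _ fun m =>
    (DirectSum.toModule K ℕ _ fun n => (bracketHom K V m n).flip).flip

end Gerstenhaber

/-! ### Quasi-twilled associative algebras -/

section QuasiTwilled

variable {K : Type*} [Field K] {𝒜 : Type*} [NonUnitalRing 𝒜] [Module K 𝒜]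
  [IsScalarTower K 𝒜 𝒜] [SMulCommClass K 𝒜 𝒜]

/-- `(𝒜, A, A')` is a quasi-twilled associative algebra: `𝒜 = A ⊕ A'` as vector spaces and `A'`
is a subalgebra of the (not necessarily unital) associative algebra `𝒜`. -/
structure IsQuasiTwilled (A A' : Submodule K 𝒜) : Prop where
  isCompl : IsCompl A A'
  mul_mem : ∀ u ∈ A', ∀ v ∈ A', u * v ∈ A'

variable {A A' : Submodule K 𝒜}

namespace IsQuasiTwilled

/-- The projection `𝒜 = A ⊕ A' → A`. -/
def fst (h : IsQuasiTwilled A A') : 𝒜 →ₗ[K] A := A.projectionOnto A' h.isCompl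

/-- The projection `𝒜 = A ⊕ A' → A'`. -/
def snd (h : IsQuasiTwilled A A') : 𝒜 →ₗ[K] A' := A'.projectionOnto A h.isCompl.symm

/-- The part of the multiplication of `𝒜` that sends `X ⊗ Y` to the target of `q`. -/
def part (X Y : Submodule K 𝒜) {Z : Submodule K 𝒜} (q : 𝒜 →ₗ[K] Z) : X →ₗ[K] Y →ₗ[K] Z :=
  ((LinearMap.mul K 𝒜).compl₁₂ X.subtype Y.subtype).compr₂ q

/-- `π : A ⊗ A → A`. -/
def mapπ (h : IsQuasiTwilled A A') : A →ₗ[K] A →ₗ[K] A := part A A h.fst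
/-- `ξ : A ⊗ A' → A`. -/
def mapξ (h : IsQuasiTwilled A A') : A →ₗ[K] A' →ₗ[K] A := part A A' h.fst
/-- `η : A' ⊗ A → A`. -/
def mapη (h : IsQuasiTwilled A A') : A' →ₗ[K] A →ₗ[K] A := part A' A h.fst
/-- `β : A' ⊗ A' → A'`. -/
def mapβ (h : IsQuasiTwilled A A') : A' →ₗ[K] A' →ₗ[K] A' := part A' A' h.snd
/-- `ρ : A ⊗ A' → A'`. -/
def mapρ (h : IsQuasiTwilled A A') : A →ₗ[K] A' →ₗ[K] A' := part A A' h.snd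
/-- `μ : A' ⊗ A → A'`. -/
def mapμ (h : IsQuasiTwilled A A') : A' →ₗ[K] A →ₗ[K] A' := part A' A h.snd
/-- `θ : A ⊗ A → A'`. -/
def mapθ (h : IsQuasiTwilled A A') : A →ₗ[K] A →ₗ[K] A' := part A A h.snd

/-- `D : A → A'` is a right deformation map of `(𝒜, A, A')`. -/
def IsRightDeformationMap (h : IsQuasiTwilled A A') (D : A →ₗ[K] A') : Prop :=
  ∀ x y : A, D (h.mapπ x y + h.mapξ x (D y) + h.mapη (D x) y) =
    h.mapρ x (D y) + h.mapμ (D x) y + h.mapβ (D x) (D y) + h.mapθ x y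

end IsQuasiTwilled

/-- A bilinear map on `V` as an element of degree `1` of `⨁_{n ≥ 0} Hom(⊗ⁿ⁺¹ V, V)`. -/
def ofBilin {V : Type*} [AddCommGroup V] [Module K V] (b : V →ₗ[K] V →ₗ[K] V) :
    Cochains K V V :=
  DirectSum.lof K ℕ (Cochain K V V) 1
    (MultilinearMap.mk' (fun x : Fin (1 + 1) → V => b (x 0) (x 1))
      (by
        intro x i a c
        fin_cases i <;> simp)
      (by
        intro x i a c
        fin_cases i <;> simp))

/-- The multiplication `Ω` of `𝒜` as a cochain of degree `1`. -/
def mulCochain (K : Type*) [Field K] (𝒜 : Type*) [NonUnitalRing 𝒜] [Module K 𝒜]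
    [IsScalarTower K 𝒜 𝒜] [SMulCommClass K 𝒜 𝒜] : Cochains K 𝒜 𝒜 :=
  ofBilin (LinearMap.mul K 𝒜)

/-- The lift to `𝒜` of a bilinear map `X ⊗ Y → Z` with `X, Y, Z ∈ {A, A'}`: compose with the
projections `p : 𝒜 → X` and `q : 𝒜 → Y` and the inclusion `Z ⊆ 𝒜`. -/
def liftBilin {X Y Z : Submodule K 𝒜} (p : 𝒜 →ₗ[K] X) (q : 𝒜 →ₗ[K] Y)
    (b : X →ₗ[K] Y →ₗ[K] Z) : Cochains K 𝒜 𝒜 :=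
  ofBilin ((b.compl₁₂ p q).compr₂ Z.subtype)

namespace IsQuasiTwilled

/-- The lift of `π`. -/
def hatπ (h : IsQuasiTwilled A A') : Cochains K 𝒜 𝒜 := liftBilin h.fst h.fst h.mapπ
/-- The lift of `ξ`. -/
def hatξ (h : IsQuasiTwilled A A') : Cochains K 𝒜 𝒜 := liftBilin h.fst h.snd h.mapξ
/-- The lift of `η`. -/
def hatη (h : IsQuasiTwilled A A') : Cochains K 𝒜 𝒜 := liftBilin h.snd h.fst h.mapη
/-- The lift of `β`. -/
def hatβ (h : IsQuasiTwilled A A') : Cochains K 𝒜 𝒜 := liftBilin h.snd h.snd h.mapβ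
/-- The lift of `ρ`. -/
def hatρ (h : IsQuasiTwilled A A') : Cochains K 𝒜 𝒜 := liftBilin h.fst h.snd h.mapρ
/-- The lift of `μ`. -/
def hatμ (h : IsQuasiTwilled A A') : Cochains K 𝒜 𝒜 := liftBilin h.snd h.fst h.mapμ
/-- The lift of `θ`. -/
def hatθ (h : IsQuasiTwilled A A') : Cochains K 𝒜 𝒜 := liftBilin h.fst h.fst h.mapθ

/-- The lift `Hom(⊗ⁿ⁺¹ A, A') → Hom(⊗ⁿ⁺¹ 𝒜, 𝒜)`: the lift of `f` is `f` on `⊗ⁿ⁺¹ A` and `0` on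
all tensor products that involve a factor `A'`. -/
def liftHom (h : IsQuasiTwilled A A') (n : ℕ) : Cochain K A A' n →ₗ[K] Cochain K 𝒜 𝒜 n where
  toFun f := A'.subtype.compMultilinearMap (f.compLinearMap fun _ => h.fst)
  map_add' f g := by ext x; simp
  map_smul' c f := by ext x; simp

/-- The lift `⨁ Hom(⊗ⁿ⁺¹ A, A') → ⨁ Hom(⊗ⁿ⁺¹ 𝒜, 𝒜)`. -/
def lift (h : IsQuasiTwilled A A') : Cochains K A A' →ₗ[K] Cochains K 𝒜 𝒜 :=
  DirectSum.lmap h.liftHom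

/-- The component in `Hom(⊗ⁿ⁺¹ A, A')` of a cochain on `𝒜`: restrict it to `⊗ⁿ⁺¹ A` and project
its values to `A'`. -/
def componentHom (h : IsQuasiTwilled A A') (n : ℕ) :
    Cochain K 𝒜 𝒜 n →ₗ[K] Cochain K A A' n where
  toFun f := h.snd.compMultilinearMap (f.compLinearMap fun _ => A.subtype)
  map_add' f g := by ext x; simp
  map_smul' c f := by ext x; simp

/-- The subspace `F = ⨁ Hom(⊗ⁿ⁺¹ A, A')` of `⨁ Hom(⊗ⁿ⁺¹ 𝒜, 𝒜)`. -/
def F (h : IsQuasiTwilled A A') : Submodule K (Cochains K 𝒜 𝒜) := LinearMap.range h.lift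

/-- The projection `P` of `⨁ Hom(⊗ⁿ⁺¹ 𝒜, 𝒜)` onto `F`, along the sum of all the other components
of the decomposition of `Hom(⊗ⁿ⁺¹ (A ⊕ A'), A ⊕ A')`. -/
def P (h : IsQuasiTwilled A A') : Cochains K 𝒜 𝒜 →ₗ[K] Cochains K 𝒜 𝒜 :=
  h.lift ∘ₗ DirectSum.lmap h.componentHom

/-- The brackets `lₖ` on `F = ⨁ Hom(⊗ⁿ⁺¹ A, A')` derived from the multiplication of `𝒜`. -/
def l (h : IsQuasiTwilled A A') (k : ℕ) : MultilinearMap K (fun _ : Fin k => h.F) h.F :=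
  derivedBracket (gerstenhaber K 𝒜) h.F h.P (fun _ => ⟨_, rfl⟩) (mulCochain K 𝒜) k

/-- The grading of `F`, with `Hom(⊗ⁿ⁺¹ A, A')` in degree `n`. -/
def gradingF (h : IsQuasiTwilled A A') : ℤ → Submodule K h.F :=
  inducedGrading (cochainGrading K 𝒜 𝒜) h.F

/-- A linear map `D : A → A'` as an element of `F`. -/
def toF (h : IsQuasiTwilled A A') (D : A →ₗ[K] A') : h.F :=
  ⟨h.lift (DirectSum.lof K ℕ (Cochain K A A') 0
    (MultilinearMap.ofSubsingleton K A A' (0 : Fin 1) D)), _, rfl⟩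

end IsQuasiTwilled

end QuasiTwilled

end QuasiTwilled

end

/-!
Give `A` weight `0` and `A'` weight `1`. The Gerstenhaber bracket adds the weights of cochains, `F`
is exactly the space of cochains of weight `1`, and there are none of weight `2` or more, so that
`F` is abelian. The components of `Ω` have weight `1` (`θ`), `0` (`π`, `ρ`, `μ`) and `-1` (`ξ`,
`η`, `β`). Each bracket with an element of `F` raises the weight by `1` and `P` discards everything
outside weight `1`, so `l₀`, `l₁`, `l₂` see one of these three parts each, and `l₃` sees none.

The Gerstenhaber bracket satisfies the graded Jacobi identity because it is the graded commutator of
`∘`, whose associator `(f ∘ g) ∘ h - f ∘ (g ∘ h)`, the sum over all insertions of `g` and `h` into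
two different arguments of `f`, is graded symmetric in `g` and `h`.

That the derived brackets of a curved V-data satisfy the `L∞` identities is Voronov's argument. By
the graded Leibniz rule `0 = [⋯[[Δ, Δ], x₁], ⋯, xₙ]` is a signed sum over the subsets `S` of
`{1, …, n}` of the brackets of `[⋯[Δ, x_S]⋯]` and `[⋯[Δ, x_Sᶜ]⋯]`. Since the kernel and the image
`F` of `P` are subalgebras and `F` is abelian, `P [a, b] = P [P a, b] + P [a, P b]`. Exchanging `S`
with its complement identifies the two resulting sums, each of which is the `L∞` expression, and
`2` is invertible.
-/

noncomputable section

namespace QuasiTwilled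

section KoszulSign

theorem prod_lt_comp_perm {ι M : Type*} [Fintype ι] [LinearOrder ι] [CommMonoid M]
    {f : ι → ι → M} (hf : ∀ a b, f a b = f b a) (σ : Equiv.Perm ι) :
    ∏ p : ι × ι with p.1 < p.2, f (σ p.1) (σ p.2) = ∏ p : ι × ι with p.1 < p.2, f p.1 p.2 := by
  let sorted (τ : Equiv.Perm ι) (p : ι × ι) : ι × ι := (min (τ p.1) (τ p.2), max (τ p.1) (τ p.2))
  have sorted_lt (τ : Equiv.Perm ι) (p : ι × ι) (hp : p.1 < p.2) :
      (sorted τ p).1 < (sorted τ p).2 := min_lt_max.mpr (τ.injective.ne hp.ne)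
  have sorted_inv (τ : Equiv.Perm ι) (p : ι × ι) (hp : p.1 < p.2) :
      sorted τ⁻¹ (sorted τ p) = p := by
    rcases le_total (τ p.1) (τ p.2) with h | h <;> simp [sorted, h, hp.le]
  refine Finset.prod_nbij' (sorted σ) (sorted σ⁻¹) ?_ ?_ ?_ ?_ fun p _ => ?_
  · simpa using fun a b => sorted_lt σ (a, b)
  · simpa using fun a b => sorted_lt σ⁻¹ (a, b)
  · simpa using fun a b => sorted_inv σ (a, b)
  · simpa using fun a b => sorted_inv σ⁻¹ (a, b)
  · rcases le_total (σ p.1) (σ p.2) with h | h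
    · simp [sorted, h]
    · simp [sorted, h, hf (σ p.1)]

theorem koszulSign_eq_prod {n : ℕ} (d : Fin n → ℤ) (σ : Equiv.Perm (Fin n)) :
    koszulSign d σ = ∏ p : Fin n × Fin n with p.1 < p.2,
      if σ p.2 < σ p.1 then (d (σ p.1) * d (σ p.2)).negOnePow else 1 := by
  rw [koszulSign, ← Finset.filter_filter, Finset.prod_filter]

theorem koszulSign_one {n : ℕ} (d : Fin n → ℤ) : koszulSign d 1 = 1 :=
  Finset.prod_eq_one fun _ hp => absurd (Finset.mem_filter.mp hp).2 fun h => h.1.asymm h.2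

theorem koszulSign_mul {n : ℕ} (d : Fin n → ℤ) (σ τ : Equiv.Perm (Fin n)) :
    koszulSign d (σ * τ) = koszulSign d σ * koszulSign (d ∘ σ) τ := by
  -- whether `σ` inverts the pair `{a, b}`, written symmetrically in `a` and `b`
  let f (a b : Fin n) : ℤˣ :=
    if (a < b ↔ σ b < σ a) then (d (σ a) * d (σ b)).negOnePow else 1
  have hf a b : f a b = f b a := by
    rcases eq_or_ne a b with rfl | hab
    · rfl
    · have := σ.injective.ne hab
      simp only [f, mul_comm (d (σ a))]
      grind
  have hσ : koszulSign d σ = ∏ p : Fin n × Fin n with p.1 < p.2, f p.1 p.2 := by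
    rw [koszulSign_eq_prod]
    refine Finset.prod_congr rfl fun p hp => ?_
    simp [f, (Finset.mem_filter.mp hp).2]
  rw [hσ, ← prod_lt_comp_perm hf τ, koszulSign_eq_prod, koszulSign_eq_prod,
    ← Finset.prod_mul_distrib]
  refine Finset.prod_congr rfl fun p hp => ?_
  have hne : τ p.1 ≠ τ p.2 := τ.injective.ne (Finset.mem_filter.mp hp).2.ne
  have _hne := σ.injective.ne hne
  simp only [f, Equiv.Perm.mul_apply, Function.comp_apply]
  have := Int.units_mul_self (d (σ (τ p.1)) * d (σ (τ p.2))).negOnePow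
  grind

theorem koszulSign_swap_castSucc_succ {n : ℕ} (d : Fin (n + 1) → ℤ) (k : Fin n) :
    koszulSign d (Equiv.swap k.castSucc k.succ) = (d k.castSucc * d k.succ).negOnePow := by
  have inversions : (Finset.univ.filter fun p : Fin (n + 1) × Fin (n + 1) => p.1 < p.2 ∧
      Equiv.swap k.castSucc k.succ p.2 < Equiv.swap k.castSucc k.succ p.1) =
        {(k.castSucc, k.succ)} := by
    ext ⟨a, b⟩
    simp only [Finset.mem_filter, Finset.mem_univ, true_and, Finset.mem_singleton, Prod.mk.injEq,
      Equiv.swap_apply_def, Fin.ext_iff, Fin.lt_def, Fin.val_castSucc, Fin.val_succ]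
    split_ifs <;> simp <;> omega
  simp [koszulSign, inversions, mul_comm]

end KoszulSign

section GradedLie

variable {K : Type*} [Field K] {L : Type*} [AddCommGroup L] [Module K L]
  {𝒢 : ℤ → Submodule K L} {br : L →ₗ[K] L →ₗ[K] L}

theorem iteratedBracket_zero (br : L →ₗ[K] L →ₗ[K] L) (u : L) (x : Fin 0 → L) :
    iteratedBracket br u 0 x = u := rfl

theorem iteratedBracket_succ (br : L →ₗ[K] L →ₗ[K] L) (u : L) (n : ℕ) (x : Fin (n + 1) → L) :
    iteratedBracket br u (n + 1) x =
      br (iteratedBracket br u n fun a => x a.castSucc) (x (Fin.last n)) := rfl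

theorem iteratedBracket_cons (br : L →ₗ[K] L →ₗ[K] L) (u y : L) {n : ℕ} (x : Fin n → L) :
    iteratedBracket br u (n + 1) (Fin.cons (α := fun _ => L) y x) =
      iteratedBracket br (br u y) n x := by
  induction n with
  | zero => rfl
  | succ n ih =>
    rw [iteratedBracket_succ, iteratedBracket_succ br (br u y), ← ih, ← Fin.succ_last,
      Fin.cons_succ]
    congr 3
    funext a
    cases a using Fin.cases <;> rfl

namespace IsGradedLieAlgebra

theorem iteratedBracket_mem (hL : IsGradedLieAlgebra 𝒢 br) {u : L} {e : ℤ} (hu : u ∈ 𝒢 e)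
    {n : ℕ} {x : Fin n → L} {d : Fin n → ℤ} (hx : ∀ a, x a ∈ 𝒢 (d a)) :
    iteratedBracket br u n x ∈ 𝒢 (e + ∑ a, d a) := by
  induction n with
  | zero => simpa [iteratedBracket_zero] using hu
  | succ n ih =>
    rw [iteratedBracket_succ, Fin.sum_univ_castSucc, ← add_assoc]
    exact hL.degree _ _ _ _ (ih fun a => hx a.castSucc) (hx _)

theorem right_leibniz (hL : IsGradedLieAlgebra 𝒢 br) {i j k : ℤ} {x y z : L} (hx : x ∈ 𝒢 i)
    (hy : y ∈ 𝒢 j) (hz : z ∈ 𝒢 k) :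
    br (br x y) z = br x (br y z) + (j * k).negOnePow • br (br x z) y := by
  have skew : br y (br x z) = -((j * (i + k)).negOnePow • br (br x z) y) :=
    hL.skew _ _ _ _ hy (hL.degree _ _ _ _ hx hz)
  rw [hL.jacobi _ _ _ _ _ _ hx hy hz, skew, smul_neg, smul_smul, ← Int.negOnePow_add,
    show i * j + j * (i + k) = (i * j + i * j) + j * k by ring, Int.negOnePow_add (i * j + i * j),
    Int.negOnePow_add (i * j), Int.units_mul_self, one_mul]
  abel

theorem bracket_bracket_comm (hL : IsGradedLieAlgebra 𝒢 br) {e i j : ℤ} {u x y : L}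
    (hu : u ∈ 𝒢 e) (hx : x ∈ 𝒢 i) (hy : y ∈ 𝒢 j) (hxy : br x y = 0) :
    br (br u x) y = (i * j).negOnePow • br (br u y) x := by
  rw [hL.right_leibniz hu hx hy, hxy, map_zero, zero_add]

theorem iteratedBracket_comp_swap (hL : IsGradedLieAlgebra 𝒢 br) {u : L} {e : ℤ} (hu : u ∈ 𝒢 e)
    {n : ℕ} {x : Fin (n + 1) → L} {d : Fin (n + 1) → ℤ} (hx : ∀ a, x a ∈ 𝒢 (d a))
    (hcomm : ∀ a b, br (x a) (x b) = 0) (k : Fin n) :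
    iteratedBracket br u (n + 1) (x ∘ Equiv.swap k.castSucc k.succ) =
      (d k.castSucc * d k.succ).negOnePow • iteratedBracket br u (n + 1) x := by
  induction n with
  | zero => exact k.elim0
  | succ n ih =>
    cases k using Fin.lastCases with
    | last =>
      have hrest (a : Fin n) : Equiv.swap (Fin.last n).castSucc (Fin.last n).succ
          a.castSucc.castSucc = a.castSucc.castSucc :=
        Equiv.swap_apply_of_ne_of_ne (by rw [Ne, Fin.ext_iff]; dsimp; omega)
          (by rw [Ne, Fin.ext_iff]; dsimp; omega)
      simp only [iteratedBracket_succ, hrest, Function.comp_apply, ← Fin.succ_last,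
        Equiv.swap_apply_left, Equiv.swap_apply_right]
      rw [mul_comm]
      exact hL.bracket_bracket_comm (hL.iteratedBracket_mem hu fun a => hx _) (hx _) (hx _)
        (hcomm _ _)
    | cast k =>
      have hlast : Equiv.swap k.castSucc.castSucc k.castSucc.succ (Fin.last (n + 1)) =
          Fin.last (n + 1) :=
        Equiv.swap_apply_of_ne_of_ne (by rw [Ne, Fin.ext_iff]; dsimp; omega)
          (by rw [Ne, Fin.ext_iff]; dsimp; omega)
      have hrest : (fun a : Fin (n + 1) => (x ∘ Equiv.swap k.castSucc.castSucc k.castSucc.succ)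
          a.castSucc) = (fun a => x a.castSucc) ∘ Equiv.swap k.castSucc k.succ := by
        funext a
        simp only [Function.comp_apply, ← Fin.castSucc_succ,
          (Fin.castSucc_injective _).map_swap]
      rw [iteratedBracket_succ, iteratedBracket_succ br u (n + 1) x, hrest, Function.comp_apply,
        hlast, ih (fun a => hx a.castSucc) fun a b => hcomm _ _]
      rw [LinearMap.map_smul_of_tower, LinearMap.smul_apply, Fin.castSucc_succ]

theorem iteratedBracket_comp_perm (hL : IsGradedLieAlgebra 𝒢 br) {u : L} {e : ℤ} (hu : u ∈ 𝒢 e)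
    {n : ℕ} {x : Fin n → L} {d : Fin n → ℤ} (hx : ∀ a, x a ∈ 𝒢 (d a))
    (hcomm : ∀ a b, br (x a) (x b) = 0) (σ : Equiv.Perm (Fin n)) :
    iteratedBracket br u n (x ∘ σ) = koszulSign d σ • iteratedBracket br u n x := by
  cases n with
  | zero => rw [Subsingleton.elim σ 1, koszulSign_one, one_smul]; rfl
  | succ n =>
    have hσ : σ ∈ Submonoid.closure
        (Set.range fun k : Fin n => Equiv.swap k.castSucc k.succ) := by
      rw [Equiv.Perm.mclosure_swap_castSucc_succ]
      trivial
    induction hσ using Submonoid.closure_induction generalizing x d with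
    | mem _ hk =>
      obtain ⟨k, rfl⟩ := hk
      rw [koszulSign_swap_castSucc_succ]
      exact hL.iteratedBracket_comp_swap hu hx hcomm k
    | one => rw [koszulSign_one, one_smul]; rfl
    | mul σ τ _ _ hσ hτ =>
      rw [koszulSign_mul, mul_comm, mul_smul, ← hσ hx hcomm]
      exact hτ (fun a => hx (σ a)) fun a b => hcomm _ _

end IsGradedLieAlgebra
end GradedLie

section Unshuffle

variable {ι : Type*} [LinearOrder ι]

/-- The Koszul sign of listing `S` before `T`: the product of `(-1)^{d_a d_b}` over all `a ∈ S` and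
`b ∈ T` with `b < a`. When `S` and `T` are complementary this is the sign of the corresponding
unshuffle. -/
def unshuffleSign (d : ι → ℤ) (S T : Finset ι) : ℤˣ :=
  ∏ p ∈ S ×ˢ T with p.2 < p.1, (d p.1 * d p.2).negOnePow

variable (d : ι → ℤ) {S T : Finset ι} {m : ι}

theorem negOnePow_sum {α : Type*} (s : Finset α) (f : α → ℤ) :
    (∑ a ∈ s, f a).negOnePow = ∏ a ∈ s, (f a).negOnePow := by
  classical
  induction s using Finset.induction_on with
  | empty => simp
  | insert a s ha ih => rw [Finset.sum_insert ha, Finset.prod_insert ha, Int.negOnePow_add, ih]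

theorem unshuffleSign_eq_prod (S T : Finset ι) :
    unshuffleSign d S T = ∏ a ∈ S, ∏ b ∈ T, if b < a then (d a * d b).negOnePow else 1 := by
  rw [unshuffleSign, Finset.prod_filter, Finset.prod_product]

theorem unshuffleSign_insert_left (hS : ∀ a ∈ S, a < m) (hT : ∀ b ∈ T, b < m) :
    unshuffleSign d (insert m S) T =
      (d m * ∑ b ∈ T, d b).negOnePow * unshuffleSign d S T := by
  rw [unshuffleSign_eq_prod, unshuffleSign_eq_prod,
    Finset.prod_insert fun hm => lt_irrefl m (hS m hm), Finset.mul_sum, negOnePow_sum]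
  exact congrArg (· * _) (Finset.prod_congr rfl fun b hb => if_pos (hT b hb))

theorem unshuffleSign_insert_right (hS : ∀ a ∈ S, a < m) (hT : ∀ b ∈ T, b < m) :
    unshuffleSign d S (insert m T) = unshuffleSign d S T := by
  rw [unshuffleSign_eq_prod, unshuffleSign_eq_prod]
  refine Finset.prod_congr rfl fun a ha => ?_
  rw [Finset.prod_insert fun hm => lt_irrefl m (hT m hm), if_neg (hS a ha).not_gt, one_mul]

theorem unshuffleSign_mul_swap (hST : Disjoint S T) :
    unshuffleSign d S T * unshuffleSign d T S =
      ((∑ a ∈ S, d a) * ∑ b ∈ T, d b).negOnePow := by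
  rw [unshuffleSign_eq_prod, unshuffleSign_eq_prod, Finset.prod_comm (s := T),
    Finset.sum_mul_sum, negOnePow_sum, ← Finset.prod_mul_distrib]
  refine Finset.prod_congr rfl fun a ha => ?_
  rw [negOnePow_sum, ← Finset.prod_mul_distrib]
  refine Finset.prod_congr rfl fun b hb => ?_
  rcases lt_or_gt_of_ne (Finset.disjoint_left.mp hST ha <| · ▸ hb : a ≠ b) with h | h <;>
    simp [h, h.not_gt, mul_comm]

end Unshuffle

section BracketAlong

variable {K : Type*} [Field K] {L : Type*} [AddCommGroup L] [Module K L]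
  {ι : Type*} [LinearOrder ι]

/-- The iterated bracket `[⋯[[u, x_{a₁}], x_{a₂}], ⋯, x_{aₖ}]` for `S = {a₁ < a₂ < ⋯ < aₖ}`. -/
def bracketAlong (br : L →ₗ[K] L →ₗ[K] L) (u : L) (x : ι → L) (S : Finset ι) : L :=
  iteratedBracket br u S.card (x ∘ S.orderEmbOfFin rfl)

variable (br : L →ₗ[K] L →ₗ[K] L) (u : L) (x : ι → L)

theorem iteratedBracket_comp_strictMono {k : ℕ} {e : Fin k → ι} (he : StrictMono e)
    {S : Finset ι} (hS : S.card = k) (hmem : ∀ a, e a ∈ S) :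
    iteratedBracket br u k (x ∘ e) = bracketAlong br u x S := by
  subst hS
  rw [bracketAlong, Finset.orderEmbOfFin_unique rfl hmem he]

theorem bracketAlong_empty : bracketAlong br u x ∅ = u := rfl

theorem bracketAlong_insert {S : Finset ι} {m : ι} (hm : ∀ a ∈ S, a < m) :
    bracketAlong br u x (insert m S) = br (bracketAlong br u x S) (x m) := by
  have hcard : (insert m S).card = S.card + 1 :=
    Finset.card_insert_of_notMem fun h => lt_irrefl m (hm m h)
  let e : Fin (S.card + 1) → ι := Fin.snoc (α := fun _ => ι) (S.orderEmbOfFin rfl) m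
  have he : StrictMono e := by
    intro a b hab
    cases b using Fin.lastCases with
    | last =>
      cases a using Fin.lastCases with
      | last => exact absurd hab (lt_irrefl _)
      | cast a => simpa [e] using hm _ (S.orderEmbOfFin_mem rfl a)
    | cast b =>
      cases a using Fin.lastCases with
      | last => exact absurd hab (Fin.le_last _).not_gt
      | cast a => simpa [e] using hab
  have hmem (a : Fin (S.card + 1)) : e a ∈ insert m S := by
    cases a using Fin.lastCases <;> simp [e]
  rw [← iteratedBracket_comp_strictMono br u x he hcard hmem, iteratedBracket_succ, bracketAlong]
  simp [e, Function.comp_def]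

variable {br} {𝒢 : ℤ → Submodule K L} {u} {x} {d : ι → ℤ} {e : ℤ}

theorem bracketAlong_zero (S : Finset ι) : bracketAlong br 0 x S = 0 := by
  induction S using Finset.induction_on_max with
  | empty => rfl
  | insert m S hm ih => rw [bracketAlong_insert br 0 x hm, ih, map_zero, LinearMap.zero_apply]

namespace IsGradedLieAlgebra

theorem bracketAlong_mem (hL : IsGradedLieAlgebra 𝒢 br) (hu : u ∈ 𝒢 e)
    (hx : ∀ a, x a ∈ 𝒢 (d a)) (S : Finset ι) : bracketAlong br u x S ∈ 𝒢 (e + ∑ a ∈ S, d a) := by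
  induction S using Finset.induction_on_max with
  | empty => simpa [bracketAlong_empty] using hu
  | insert m S hm ih =>
    rw [bracketAlong_insert br u x hm, Finset.sum_insert fun h => lt_irrefl m (hm m h),
      add_left_comm, add_comm]
    exact hL.degree _ _ _ _ ih (hx m)

theorem bracket_bracketAlong (hL : IsGradedLieAlgebra 𝒢 br) (hu : u ∈ 𝒢 e)
    (hx : ∀ a, x a ∈ 𝒢 (d a)) {y : L} {i : ℤ} (hy : y ∈ 𝒢 i) (hxy : ∀ a, br (x a) y = 0)
    (S : Finset ι) :
    br (bracketAlong br u x S) y =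
      ((∑ a ∈ S, d a) * i).negOnePow • bracketAlong br (br u y) x S := by
  induction S using Finset.induction_on_max with
  | empty => simp [bracketAlong_empty]
  | insert m S hm ih =>
    rw [bracketAlong_insert br u x hm, bracketAlong_insert br _ x hm,
      Finset.sum_insert fun h => lt_irrefl m (hm m h),
      hL.bracket_bracket_comm (hL.bracketAlong_mem hu hx S) (hx m) hy (hxy m), ih,
      LinearMap.map_smul_of_tower, LinearMap.smul_apply, smul_smul, add_mul, Int.negOnePow_add]

theorem bracketAlong_bracket (hL : IsGradedLieAlgebra 𝒢 br) {v : L} {c : ℤ} (hu : u ∈ 𝒢 c)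
    (hv : v ∈ 𝒢 e) (hx : ∀ a, x a ∈ 𝒢 (d a)) (T : Finset ι) :
    bracketAlong br (br u v) x T = ∑ S ∈ T.powerset,
      (unshuffleSign d S (T \ S) * ((∑ a ∈ S, d a) * e).negOnePow) •
        br (bracketAlong br u x S) (bracketAlong br v x (T \ S)) := by
  induction T using Finset.induction_on_max with
  | empty => simp [bracketAlong_empty, unshuffleSign]
  | insert m T hm ih =>
    have hmT : m ∉ T := fun h => lt_irrefl m (hm m h)
    rw [bracketAlong_insert br _ x hm, ih, Finset.sum_powerset_insert hmT,
      ← Finset.sum_add_distrib, map_sum, LinearMap.sum_apply]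
    refine Finset.sum_congr rfl fun S hS => ?_
    have hST : S ⊆ T := Finset.mem_powerset.mp hS
    have hmS : ∀ a ∈ S, a < m := fun a ha => hm a (hST ha)
    have hmT' : ∀ a ∈ T \ S, a < m := fun a ha => hm a (Finset.sdiff_subset ha)
    have hm_notMem : m ∉ S := fun h => hmT (hST h)
    have sign : unshuffleSign d S (T \ S) * ((∑ a ∈ S, d a) * e).negOnePow *
        ((e + ∑ a ∈ T \ S, d a) * d m).negOnePow =
        (d m * ∑ a ∈ T \ S, d a).negOnePow * unshuffleSign d S (T \ S) *
          ((d m + ∑ a ∈ S, d a) * e).negOnePow := by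
      rw [mul_comm _ (d m), mul_add, add_mul, Int.negOnePow_add, Int.negOnePow_add,
        mul_comm (d m * e).negOnePow, mul_mul_mul_comm, mul_comm (unshuffleSign d S (T \ S)),
        mul_comm (d m * e).negOnePow]
    rw [Finset.insert_sdiff_of_notMem T hm_notMem, Finset.insert_sdiff_insert,
      Finset.sdiff_insert_of_notMem hmT, unshuffleSign_insert_right d hmS hmT',
      unshuffleSign_insert_left d hmS hmT', Finset.sum_insert hm_notMem,
      bracketAlong_insert br u x hmS, bracketAlong_insert br v x hmT',
      LinearMap.map_smul_of_tower, LinearMap.smul_apply,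
      hL.right_leibniz (hL.bracketAlong_mem hu hx S) (hL.bracketAlong_mem hv hx (T \ S)) (hx m),
      smul_add, smul_smul]
    exact congrArg (_ + · • br (br (bracketAlong br u x S) (x m)) (bracketAlong br v x (T \ S)))
      sign

end IsGradedLieAlgebra

end BracketAlong

section CurvedVData

variable {K : Type*} [Field K] {L : Type*} [AddCommGroup L] [Module K L]
  {𝒢 : ℤ → Submodule K L} {br : L →ₗ[K] L →ₗ[K] L} {F : Submodule K L} {P : L →ₗ[K] L} {Δ : L}

theorem IsGradedLieSubalgebra.inducedGrading_isInternal (h𝒢 : DirectSum.IsInternal 𝒢)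
    (hF : IsGradedLieSubalgebra 𝒢 br F) : DirectSum.IsInternal (inducedGrading 𝒢 F) := by
  rw [DirectSum.isInternal_submodule_iff_iSupIndep_and_iSup_eq_top] at h𝒢 ⊢
  constructor
  · intro i
    rw [Submodule.disjoint_def]
    intro x hx hx'
    have hle : ⨆ j, ⨆ (_ : j ≠ i), inducedGrading 𝒢 F j ≤
        (⨆ j, ⨆ (_ : j ≠ i), 𝒢 j).comap F.subtype :=
      iSup₂_le fun j hj => Submodule.comap_mono (le_iSup₂_of_le j hj le_rfl)
    exact Subtype.ext (Submodule.disjoint_def.mp (h𝒢.1 i) x hx (hle hx'))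
  · rw [← (Submodule.map_injective_of_injective F.injective_subtype).eq_iff, Submodule.map_iSup,
      Submodule.map_top, Submodule.range_subtype]
    conv_rhs => rw [hF.graded]
    exact iSup_congr fun i => by
      rw [inducedGrading, Submodule.map_comap_eq, Submodule.range_subtype]

theorem eq_inf_sup_inf_of_isInternal {ι : Type*} [DecidableEq ι] {𝒢 : ι → Submodule K L}
    (h𝒢 : DirectSum.IsInternal 𝒢) {S T : Submodule K L} (hS : S = ⨆ i, S ⊓ 𝒢 i)
    (hT : T = ⨆ i, T ⊓ 𝒢 i) (hST : S ⊔ T = ⊤) (i : ι) : 𝒢 i = S ⊓ 𝒢 i ⊔ T ⊓ 𝒢 i := by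
  let M (j : ι) : Submodule K L := S ⊓ 𝒢 j ⊔ T ⊓ 𝒢 j
  have hM (j : ι) : M j ≤ 𝒢 j := sup_le inf_le_right inf_le_right
  have hrest : (⨆ (j) (_ : j ≠ i), M j) ⊓ 𝒢 i = ⊥ :=
    (h𝒢.submodule_iSupIndep i).symm.mono_left (iSup₂_mono fun j _ => hM j) |>.eq_bot
  calc 𝒢 i = (⨆ j, M j) ⊓ 𝒢 i := by rw [iSup_sup_eq, ← hS, ← hT, hST, top_inf_eq]
    _ = M i ⊔ (⨆ (j) (_ : j ≠ i), M j) ⊓ 𝒢 i := by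
      rw [iSup_split_single M i, sup_inf_assoc_of_le _ (hM i)]
    _ = M i := by rw [hrest, sup_bot_eq]

theorem coe_derivedBracket (hP : ∀ x, P x ∈ F) (k : ℕ) (x : Fin k → F) :
    (derivedBracket br F P hP Δ k x : L) = P (iteratedBracket br Δ k fun a => x a) := rfl

namespace IsCurvedVData

theorem proj_proj (H : IsCurvedVData 𝒢 br F P Δ) (x : L) : P (P x) = P x :=
  LinearMap.congr_fun H.proj x

theorem proj_mem (H : IsCurvedVData 𝒢 br F P Δ) (x : L) : P x ∈ F :=
  H.range_proj ▸ LinearMap.mem_range_self P x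

theorem proj_eq_self (H : IsCurvedVData 𝒢 br F P Δ) {x : L} (hx : x ∈ F) : P x = x := by
  obtain ⟨y, rfl⟩ := H.range_proj.symm ▸ hx
  exact H.proj_proj y

theorem sub_proj_mem_ker (H : IsCurvedVData 𝒢 br F P Δ) (x : L) : x - P x ∈ LinearMap.ker P := by
  rw [LinearMap.mem_ker, map_sub, H.proj_proj, sub_self]

theorem proj_mem_grading (H : IsCurvedVData 𝒢 br F P Δ) {i : ℤ} {x : L} (hx : x ∈ 𝒢 i) :
    P x ∈ 𝒢 i := by
  have htop : F ⊔ LinearMap.ker P = ⊤ := eq_top_iff.mpr fun x _ =>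
    Submodule.mem_sup.mpr ⟨P x, H.proj_mem x, x - P x, H.sub_proj_mem_ker x, add_sub_cancel _ _⟩
  rw [eq_inf_sup_inf_of_isInternal H.gradedLie.internal H.subalgebra.graded H.ker_proj.graded
    htop i] at hx
  obtain ⟨f, hf, k, hk, rfl⟩ := Submodule.mem_sup.mp hx
  rw [map_add, H.proj_eq_self hf.1, LinearMap.mem_ker.mp hk.1, add_zero]
  exact hf.2

-- Expand `P [x - P x, y - P y] = 0`: the kernel of `P` is a subalgebra and `[P x, P y] = 0`.
theorem proj_bracket (H : IsCurvedVData 𝒢 br F P Δ) (x y : L) :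
    P (br x y) = P (br (P x) y) + P (br x (P y)) := by
  have h := LinearMap.mem_ker.mp <|
    H.ker_proj.closed _ (H.sub_proj_mem_ker x) _ (H.sub_proj_mem_ker y)
  simp only [map_sub, LinearMap.sub_apply, H.abelian _ (H.proj_mem x) _ (H.proj_mem y),
    sub_zero] at h
  rw [← sub_eq_zero, ← h]
  abel

variable {ι : Type*} [LinearOrder ι] {x : ι → L} {d : ι → ℤ}

theorem bracket_proj_bracketAlong (H : IsCurvedVData 𝒢 br F P Δ) (hxF : ∀ a, x a ∈ F)
    (hx : ∀ a, x a ∈ 𝒢 (d a)) (S T : Finset ι) :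
    br (bracketAlong br Δ x T) (P (bracketAlong br Δ x S)) =
      ((∑ b ∈ T, d b) * (1 + ∑ a ∈ S, d a)).negOnePow •
        bracketAlong br (br Δ (P (bracketAlong br Δ x S))) x T :=
  H.gradedLie.bracket_bracketAlong H.degree_one hx
    (H.proj_mem_grading (H.gradedLie.bracketAlong_mem H.degree_one hx S))
    (fun a => H.abelian _ (hxF a) _ (H.proj_mem _)) T

theorem proj_bracket_bracketAlong (H : IsCurvedVData 𝒢 br F P Δ) (hxF : ∀ a, x a ∈ F)
    (hx : ∀ a, x a ∈ 𝒢 (d a)) {S T : Finset ι} (hST : Disjoint S T) :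
    (unshuffleSign d S T * ((∑ a ∈ S, d a) * 1).negOnePow) •
        P (br (bracketAlong br Δ x S) (bracketAlong br Δ x T)) =
      unshuffleSign d S T • P (bracketAlong br (br Δ (P (bracketAlong br Δ x S))) x T) +
        unshuffleSign d T S • P (bracketAlong br (br Δ (P (bracketAlong br Δ x T))) x S) := by
  have hS := H.gradedLie.bracketAlong_mem H.degree_one hx S
  have hT := H.gradedLie.bracketAlong_mem H.degree_one hx T
  have skew := H.gradedLie.skew _ _ _ _ (H.proj_mem_grading hS) hT
  have swap := unshuffleSign_mul_swap d hST
  rw [H.bracket_proj_bracketAlong hxF hx] at skew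
  rw [H.proj_bracket, skew, H.bracket_proj_bracketAlong hxF hx, map_neg]
  simp only [LinearMap.map_smul_of_tower, smul_add, smul_smul, ← Units.neg_smul]
  set s := ∑ a ∈ S, d a
  set t := ∑ b ∈ T, d b
  have sign_left : unshuffleSign d S T * (s * 1).negOnePow *
      -(((1 + s) * (1 + t)).negOnePow * (t * (1 + s)).negOnePow) = unshuffleSign d S T := by
    rw [mul_assoc, ← Int.negOnePow_add, ← Int.negOnePow_succ, ← Int.negOnePow_add,
      Int.negOnePow_even _ ⟨(1 + s) * (1 + t), by ring⟩, mul_one]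
  have sign_right : unshuffleSign d S T * (s * 1).negOnePow * (s * (1 + t)).negOnePow =
      unshuffleSign d T S := by
    rw [mul_assoc, ← Int.negOnePow_add, show s * 1 + s * (1 + t) = s + s + s * t by ring,
      Int.negOnePow_add, Int.negOnePow_add, Int.units_mul_self, one_mul, ← swap, ← mul_assoc,
      Int.units_mul_self, one_mul]
  exact congrArg₂ (fun u v : ℤˣ => u • (_ : L) + v • (_ : L)) sign_left sign_right

theorem sum_unshuffleSign_smul_eq_zero (H : IsCurvedVData 𝒢 br F P Δ) (hK : (2 : K) ≠ 0)
    (hxF : ∀ a, x a ∈ F) (hx : ∀ a, x a ∈ 𝒢 (d a)) (T : Finset ι) :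
    ∑ S ∈ T.powerset, unshuffleSign d S (T \ S) •
      P (bracketAlong br (br Δ (P (bracketAlong br Δ x S))) x (T \ S)) = 0 := by
  let a (S R : Finset ι) : L :=
    unshuffleSign d S R • P (bracketAlong br (br Δ (P (bracketAlong br Δ x S))) x R)
  have complement : ∑ S ∈ T.powerset, a (T \ S) S = ∑ S ∈ T.powerset, a S (T \ S) :=
    Finset.sum_nbij' (T \ ·) (T \ ·) (by simp) (by simp) (by simp) (by simp) (by simp +contextual)
  refine (smul_eq_zero_iff_right hK).mp ?_
  calc (2 : K) • ∑ S ∈ T.powerset, a S (T \ S)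
      = ∑ S ∈ T.powerset, (a S (T \ S) + a (T \ S) S) := by
        rw [two_smul, Finset.sum_add_distrib, complement]
    _ = ∑ S ∈ T.powerset, (unshuffleSign d S (T \ S) * ((∑ a ∈ S, d a) * 1).negOnePow) •
          P (br (bracketAlong br Δ x S) (bracketAlong br Δ x (T \ S))) :=
        Finset.sum_congr rfl fun S _ =>
          (H.proj_bracket_bracketAlong hxF hx Finset.disjoint_sdiff).symm
    _ = P (bracketAlong br (br Δ Δ) x T) := by
        rw [H.gradedLie.bracketAlong_bracket H.degree_one H.degree_one hx, map_sum]
        simp only [LinearMap.map_smul_of_tower]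
    _ = 0 := by rw [H.square_zero, bracketAlong_zero, map_zero]

end IsCurvedVData
end CurvedVData

section Shuffle

variable {n : ℕ}

/-- The set `{σ(1), …, σ(i)}`; an `(i, n - i)`-shuffle is determined by it. -/
def leadingValues (i : ℕ) (σ : Equiv.Perm (Fin n)) : Finset (Fin n) :=
  {b | (σ.symm b : ℕ) < i}

variable {i : ℕ} {σ τ : Equiv.Perm (Fin n)}

theorem mem_leadingValues {b : Fin n} : b ∈ leadingValues i σ ↔ (σ.symm b : ℕ) < i := by
  simp [leadingValues]

theorem card_leadingValues (hi : i ≤ n) (σ : Equiv.Perm (Fin n)) :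
    (leadingValues i σ).card = i := by
  have h : leadingValues i σ = (Finset.univ.filter fun a : Fin n => (a : ℕ) < i).map σ := by
    ext b
    simp [mem_leadingValues, Finset.mem_map_equiv]
  rw [h, Finset.card_map, Fin.card_filter_val_lt, min_eq_right hi]

theorem card_compl_leadingValues (hi : i ≤ n) (σ : Equiv.Perm (Fin n)) :
    (leadingValues i σ)ᶜ.card = n - i := by
  rw [Finset.card_compl, Fintype.card_fin, card_leadingValues hi]

theorem apply_mem_leadingValues (hi : i ≤ n) (a : Fin i) :
    σ (a.castLE hi) ∈ leadingValues i σ := by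
  simp [mem_leadingValues]

theorem apply_mem_compl_leadingValues (b : Fin (n - i)) :
    σ ⟨i + b, by omega⟩ ∈ (leadingValues i σ)ᶜ := by
  simp [mem_leadingValues]

namespace IsShuffle

theorem strictMono_leading (hσ : IsShuffle i σ) (hi : i ≤ n) :
    StrictMono fun a : Fin i => σ (a.castLE hi) :=
  fun _ b hab => hσ _ _ hab (.inl b.isLt)

theorem strictMono_trailing (hσ : IsShuffle i σ) :
    StrictMono fun b : Fin (n - i) => σ ⟨i + b, by omega⟩ :=
  fun _ _ hab => hσ _ _ (Nat.add_lt_add_left hab i) (.inr (Nat.le_add_right _ _))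

theorem koszulSign_eq (hσ : IsShuffle i σ) (d : Fin n → ℤ) :
    koszulSign d σ = unshuffleSign d (leadingValues i σ) (leadingValues i σ)ᶜ := by
  refine Finset.prod_nbij' (Prod.map σ σ) (Prod.map σ.symm σ.symm) ?_ ?_ (by simp) (by simp)
    fun _ _ => rfl
  · rintro ⟨a, b⟩ hab
    obtain ⟨hlt, hinv⟩ := (Finset.mem_filter.mp hab).2
    have split : ¬((b : ℕ) < i ∨ i ≤ (a : ℕ)) := mt (hσ a b hlt) hinv.not_gt
    simp only [Finset.mem_filter, Finset.mem_product, Finset.mem_compl, mem_leadingValues,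
      Prod.map_fst, Prod.map_snd, Equiv.symm_apply_apply]
    exact ⟨by omega, hinv⟩
  · rintro ⟨a, b⟩ hab
    simp only [Finset.mem_filter, Finset.mem_product, Finset.mem_compl, mem_leadingValues] at hab
    refine Finset.mem_filter.mpr ⟨Finset.mem_univ _, ?_, ?_⟩
    · exact hab.1.1.trans_le (not_lt.mp hab.1.2)
    · simpa only [Prod.map_fst, Prod.map_snd, Equiv.apply_symm_apply] using hab.2

theorem eq_of_leadingValues_eq (hσ : IsShuffle i σ) (hτ : IsShuffle i τ) (hi : i ≤ n)
    (h : leadingValues i σ = leadingValues i τ) : σ = τ := by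
  have leading : (fun a : Fin i => σ (a.castLE hi)) = fun a : Fin i => τ (a.castLE hi) :=
    (Finset.orderEmbOfFin_unique (card_leadingValues hi τ)
      (fun a => h ▸ apply_mem_leadingValues hi a) (hσ.strictMono_leading hi)).trans
    (Finset.orderEmbOfFin_unique (card_leadingValues hi τ)
      (apply_mem_leadingValues hi) (hτ.strictMono_leading hi)).symm
  have trailing : (fun b : Fin (n - i) => σ ⟨i + b, by omega⟩) =
      fun b : Fin (n - i) => τ ⟨i + b, by omega⟩ :=
    (Finset.orderEmbOfFin_unique (card_compl_leadingValues hi τ)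
      (fun b => h ▸ apply_mem_compl_leadingValues b) hσ.strictMono_trailing).trans
    (Finset.orderEmbOfFin_unique (card_compl_leadingValues hi τ)
      apply_mem_compl_leadingValues hτ.strictMono_trailing).symm
  ext1 a
  rcases lt_or_ge (a : ℕ) i with ha | ha
  · exact congrFun leading ⟨a, ha⟩
  · simpa [Nat.add_sub_cancel' ha] using congrFun trailing ⟨a - i, by omega⟩

end IsShuffle

theorem exists_isShuffle_leadingValues_eq (hi : i ≤ n) {S : Finset (Fin n)} (hS : S.card = i) :
    ∃ σ, IsShuffle i σ ∧ leadingValues i σ = S := by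
  have hSc : Sᶜ.card = n - i := by rw [Finset.card_compl, Fintype.card_fin, hS]
  let σ : Equiv.Perm (Fin n) := (finCongr (Nat.add_sub_cancel' hi).symm).trans
    (finSumFinEquiv.symm.trans (finSumEquivOfFinset hS hSc))
  have leading (a : Fin n) (ha : (a : ℕ) < i) : σ a = S.orderEmbOfFin hS ⟨a, ha⟩ := by
    rw [← finSumEquivOfFinset_inl hS hSc, Equiv.trans_apply, Equiv.trans_apply]
    congr 1
    rw [Equiv.symm_apply_eq]
    rfl
  have trailing (a : Fin n) (ha : i ≤ (a : ℕ)) :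
      σ a = Sᶜ.orderEmbOfFin hSc ⟨a - i, by omega⟩ := by
    rw [← finSumEquivOfFinset_inr hS hSc, Equiv.trans_apply, Equiv.trans_apply]
    congr 1
    rw [Equiv.symm_apply_eq]
    ext
    simp [Nat.add_sub_cancel' ha]
  refine ⟨σ, fun a b hab h => ?_, ?_⟩
  · rcases h with hb | ha
    · rw [leading a (lt_trans hab hb), leading b hb]
      simpa using hab
    · rw [trailing a ha, trailing b (ha.trans hab.le)]
      simp; omega
  · refine Finset.eq_of_subset_of_card_le (fun b hb => ?_) (by rw [card_leadingValues hi, hS])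
    rw [mem_leadingValues] at hb
    rw [← σ.apply_symm_apply b, leading _ hb]
    exact S.orderEmbOfFin_mem hS _

open Classical in
theorem sum_isShuffle {M : Type*} [AddCommMonoid M] (hi : i ≤ n) (f : Finset (Fin n) → M) :
    ∑ σ : Equiv.Perm (Fin n) with IsShuffle i σ, f (leadingValues i σ) =
      ∑ S ∈ Finset.univ.powersetCard i, f S := by
  refine Finset.sum_nbij (leadingValues i) ?_ ?_ ?_ fun _ _ => rfl
  · exact fun σ _ => Finset.mem_powersetCard_univ.mpr (card_leadingValues hi σ)
  · exact fun σ hσ τ hτ => (Finset.mem_filter.mp hσ).2.eq_of_leadingValues_eq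
      (Finset.mem_filter.mp hτ).2 hi
  · intro S hS
    obtain ⟨σ, hσ, rfl⟩ := exists_isShuffle_leadingValues_eq hi (Finset.mem_powersetCard_univ.mp hS)
    exact ⟨σ, by simpa using hσ, rfl⟩

end Shuffle

section CurvedLInfinity

variable {K : Type*} [Field K] {L : Type*} [AddCommGroup L] [Module K L]
  {𝒢 : ℤ → Submodule K L} {br : L →ₗ[K] L →ₗ[K] L} {F : Submodule K L} {P : L →ₗ[K] L} {Δ : L}

theorem coe_nestedTerm_derivedBracket (hP : ∀ x, P x ∈ F) {n : ℕ} {i : Fin (n + 1)}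
    {σ : Equiv.Perm (Fin n)} (hσ : IsShuffle i σ) (x : Fin n → F) :
    (nestedTerm (L := F) (derivedBracket br F P hP Δ) i (fun a => x (σ a)) : L) =
      P (bracketAlong br (br Δ (P (bracketAlong br Δ (fun a => (x a : L)) (leadingValues i σ))))
        (fun a => (x a : L)) (leadingValues i σ)ᶜ) := by
  have hi : (i : ℕ) ≤ n := i.is_le
  rw [← iteratedBracket_comp_strictMono br Δ (fun a => (x a : L)) (hσ.strictMono_leading hi)
      (card_leadingValues hi σ) (apply_mem_leadingValues hi),
    ← iteratedBracket_comp_strictMono br _ (fun a => (x a : L)) hσ.strictMono_trailing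
      (card_compl_leadingValues hi σ) apply_mem_compl_leadingValues, ← iteratedBracket_cons,
    nestedTerm, coe_derivedBracket]
  congr 2
  funext a
  cases a using Fin.cases <;> rfl

open Classical in
theorem coe_sum_nestedTerm_derivedBracket (hP : ∀ x, P x ∈ F) {n : ℕ} (x : Fin n → F)
    (d : Fin n → ℤ) :
    ((∑ i : Fin (n + 1), ∑ σ : Equiv.Perm (Fin n) with IsShuffle i σ, koszulSign d σ •
        nestedTerm (L := F) (derivedBracket br F P hP Δ) i (fun a => x (σ a)) : F) : L) =
      ∑ S ∈ Finset.univ.powerset, unshuffleSign d S (Finset.univ \ S) •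
        P (bracketAlong br (br Δ (P (bracketAlong br Δ (fun a => (x a : L)) S)))
          (fun a => (x a : L)) (Finset.univ \ S)) := by
  rw [Finset.sum_powerset, Finset.card_univ, Fintype.card_fin, Finset.sum_range,
    ← F.subtype_apply, map_sum]
  refine Finset.sum_congr rfl fun i _ => ?_
  rw [← sum_isShuffle i.is_le, map_sum]
  refine Finset.sum_congr rfl fun σ hσ => ?_
  have hσ := (Finset.mem_filter.mp hσ).2
  rw [LinearMap.map_smul_of_tower, F.subtype_apply, coe_nestedTerm_derivedBracket hP hσ,
    hσ.koszulSign_eq, Finset.compl_eq_univ_sdiff]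

theorem IsCurvedVData.isCurvedLInfinity (H : IsCurvedVData 𝒢 br F P Δ) (hK : (2 : K) ≠ 0)
    (hP : ∀ x, P x ∈ F) :
    IsCurvedLInfinity (inducedGrading 𝒢 F) (derivedBracket br F P hP Δ) where
  internal := H.subalgebra.inducedGrading_isInternal H.gradedLie.internal
  degree k x d hx := by
    rw [add_comm]
    exact H.proj_mem_grading (H.gradedLie.iteratedBracket_mem H.degree_one hx)
  symm n x d hx σ := Subtype.ext <| by
    have hxx (a b : Fin n) : br (x a) (x b) = 0 := H.abelian _ (x a).2 _ (x b).2
    exact (congrArg P (H.gradedLie.iteratedBracket_comp_perm H.degree_one hx hxx σ)).trans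
      (P.map_smul_of_tower _ _)
  jacobi n x d hx := Subtype.ext <| (coe_sum_nestedTerm_derivedBracket hP x d).trans <|
    H.sum_unshuffleSign_smul_eq_zero hK (fun a => (x a).2) hx Finset.univ

theorem derivedBracket_eq_zero (hP : ∀ x, P x ∈ F) {m : ℕ}
    (hm : ∀ x : Fin m → L, (∀ a, x a ∈ F) → iteratedBracket br Δ m x = 0) {k : ℕ} (hk : m ≤ k) :
    derivedBracket br F P hP Δ k = 0 := by
  have iterated_eq_zero : ∀ x : Fin k → L, (∀ a, x a ∈ F) → iteratedBracket br Δ k x = 0 := by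
    induction k, hk using Nat.le_induction with
    | base => exact hm
    | succ k _ ih =>
      intro x hx
      rw [iteratedBracket_succ, ih _ fun a => hx _, map_zero, LinearMap.zero_apply]
  ext x
  rw [coe_derivedBracket, iterated_eq_zero _ fun a => (x a).2, map_zero]
  rfl

end CurvedLInfinity

section GradedPreLie

variable {K : Type*} [Field K] {L : Type*} [AddCommGroup L] [Module K L]
  {𝒢 : ℤ → Submodule K L} {br C : L →ₗ[K] L →ₗ[K] L}

/-- `C` is a graded right pre-Lie product: its associator is graded symmetric in the last two
arguments. The Gerstenhaber composition product is of this kind. -/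
structure IsGradedPreLie (𝒢 : ℤ → Submodule K L) (C : L →ₗ[K] L →ₗ[K] L) : Prop where
  degree : ∀ i j x y, x ∈ 𝒢 i → y ∈ 𝒢 j → C x y ∈ 𝒢 (i + j)
  associator : ∀ i j k x y z, x ∈ 𝒢 i → y ∈ 𝒢 j → z ∈ 𝒢 k →
    C (C x y) z - C x (C y z) = (j * k).negOnePow • (C (C x z) y - C x (C z y))

namespace IsGradedPreLie

theorem commutator_mem (hC : IsGradedPreLie 𝒢 C) {i j : ℤ} {x y : L} (hx : x ∈ 𝒢 i)
    (hy : y ∈ 𝒢 j) : C x y - (i * j).negOnePow • C y x ∈ 𝒢 (i + j) :=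
  sub_mem (hC.degree _ _ _ _ hx hy)
    (Submodule.smul_of_tower_mem _ _ (add_comm j i ▸ hC.degree _ _ _ _ hy hx))

theorem isGradedLieAlgebra (hC : IsGradedPreLie 𝒢 C) (h𝒢 : DirectSum.IsInternal 𝒢)
    (hbr : ∀ i j x y, x ∈ 𝒢 i → y ∈ 𝒢 j → br x y = C x y - (i * j).negOnePow • C y x) :
    IsGradedLieAlgebra 𝒢 br where
  internal := h𝒢
  degree i j x y hx hy := hbr i j x y hx hy ▸ hC.commutator_mem hx hy
  skew i j x y hx hy := by
    rw [hbr i j x y hx hy, hbr j i y x hy hx, mul_comm j i, smul_sub, smul_smul,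
      Int.units_mul_self, one_smul, neg_sub]
  jacobi i j k x y z hx hy hz := by
    have hxyz := hC.associator i j k x y z hx hy hz
    have hyxz := hC.associator j i k y x z hy hx hz
    have hzxy := hC.associator k i j z x y hz hx hy
    have bracket_mem {i j : ℤ} {x y : L} (hx : x ∈ 𝒢 i) (hy : y ∈ 𝒢 j) : br x y ∈ 𝒢 (i + j) :=
      hbr i j x y hx hy ▸ hC.commutator_mem hx hy
    rw [hbr _ _ _ _ hx (bracket_mem hy hz), hbr _ _ _ _ (bracket_mem hx hy) hz,
      hbr _ _ _ _ hy (bracket_mem hx hz), hbr j k y z hy hz, hbr i j x y hx hy, hbr i k x z hx hz]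
    simp only [mul_add, add_mul, Int.negOnePow_add, mul_comm j i]
    generalize (i * j).negOnePow = a at *
    generalize (i * k).negOnePow = b at *
    generalize (j * k).negOnePow = c at *
    have combination := congrArg₂ (· - ·) (congrArg₂ (· - ·) (congrArg (a • ·) hyxz) hxyz)
      (congrArg ((b * c) • ·) hzxy)
    rcases Int.units_eq_one_or a with rfl | rfl <;> rcases Int.units_eq_one_or b with rfl | rfl <;>
      rcases Int.units_eq_one_or c with rfl | rfl <;>
      simp only [one_smul, Units.neg_smul, mul_one, mul_neg, neg_neg, map_sub,
        map_neg, LinearMap.sub_apply, LinearMap.neg_apply] at combination ⊢ <;>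
      · rw [← sub_eq_zero] at combination ⊢
        rw [← combination]
        abel

end IsGradedPreLie

end GradedPreLie

section Sequences

/-- The sequence `x₀, …, x_{i-1}, v, x_{i+n+1}, …`, in which the `n + 1` terms `x_i, …, x_{i+n}`
are replaced by `v`. Infinite sequences replace tuples so that partial compositions of cochains
can be compared without casts between `Fin (m + n + p + 1)` and `Fin (m + (n + p) + 1)`. -/
def replaceBlock {α : Type*} (i n : ℕ) (v : α) (x : ℕ → α) : ℕ → α := fun j =>
  if j < i then x j else if j = i then v else x (j + n)

variable {α : Type*} {i : ℕ} (n : ℕ) (v : α) (x : ℕ → α)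

theorem replaceBlock_of_lt {j : ℕ} (hj : j < i) : replaceBlock i n v x j = x j := if_pos hj

theorem replaceBlock_self : replaceBlock i n v x i = v := by simp [replaceBlock]

theorem replaceBlock_of_gt {j : ℕ} (hj : i < j) : replaceBlock i n v x j = x (j + n) := by
  rw [replaceBlock, if_neg hj.not_gt, if_neg hj.ne']

theorem replaceBlock_add (k p : ℕ) :
    (fun l => replaceBlock (i + k) p v x (i + l)) = replaceBlock k p v fun l => x (i + l) := by
  funext l
  simp only [replaceBlock, add_lt_add_iff_left, add_right_inj, add_assoc]

theorem replaceBlock_replaceBlock_nested {k p : ℕ} (hk : k ≤ n) (w : α) :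
    replaceBlock i n v (replaceBlock (i + k) p w x) = replaceBlock i (n + p) v x := by
  funext j
  rcases lt_trichotomy j i with hj | rfl | hj
  · rw [replaceBlock_of_lt _ _ _ hj, replaceBlock_of_lt _ _ _ hj,
      replaceBlock_of_lt _ _ _ (by omega)]
  · rw [replaceBlock_self, replaceBlock_self]
  · rw [replaceBlock_of_gt _ _ _ hj, replaceBlock_of_gt _ _ _ hj,
      replaceBlock_of_gt _ _ _ (by omega), add_assoc]

theorem replaceBlock_replaceBlock_comm {a b p q : ℕ} (hab : a < b) (u : α) :
    replaceBlock a p u (replaceBlock (b + p) q v x) =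
      replaceBlock b q v (replaceBlock a p u x) := by
  funext j
  simp only [replaceBlock]
  split_ifs <;> first | rfl | omega | (congr 1; omega)

theorem sum_range_replaceBlock {M : Type*} [AddCommMonoid M] {m : ℕ} (hi : i ≤ m) (c : M)
    (t : ℕ → M) :
    ∑ j ∈ Finset.range (m + 1), replaceBlock i n c t j =
      ∑ j ∈ Finset.range i, t j + c + ∑ b ∈ Finset.Ico (i + 1) (m + 1), t (b + n) := by
  rw [← Finset.sum_range_add_sum_Ico _ (show i + 1 ≤ m + 1 by omega), Finset.sum_range_succ,
    replaceBlock_self]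
  refine congrArg₂ (· + c + ·) (Finset.sum_congr rfl fun j hj => ?_)
    (Finset.sum_congr rfl fun b hb => ?_)
  · exact replaceBlock_of_lt _ _ _ (Finset.mem_range.mp hj)
  · exact replaceBlock_of_gt _ _ _ (Nat.lt_of_succ_le (Finset.mem_Ico.mp hb).1)

theorem sum_range_eq_sum_blocks {M : Type*} [AddCommMonoid M] {m : ℕ} (hi : i ≤ m) (t : ℕ → M) :
    ∑ j ∈ Finset.range (m + n + 1), t j = ∑ j ∈ Finset.range i, t j +
      ∑ k ∈ Finset.range (n + 1), t (i + k) + ∑ b ∈ Finset.Ico (i + 1) (m + 1), t (b + n) := by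
  obtain ⟨r, rfl⟩ := Nat.exists_eq_add_of_le hi
  rw [show i + r + n + 1 = i + (n + 1) + r by omega, Finset.sum_range_add, Finset.sum_range_add,
    Finset.sum_Ico_eq_sum_range, show i + r + 1 - (i + 1) = r by omega]
  congr 1
  exact Finset.sum_congr rfl fun k _ => congrArg t (by omega)

end Sequences

section Cochains

variable {K : Type*} [Field K] {V W : Type*} [AddCommGroup V] [Module K V]
  [AddCommGroup W] [Module K W]

/-- The value of a cochain on the first `n + 1` terms of a sequence. -/
def evalSeq {n : ℕ} : Cochain K V W n →ₗ[K] (ℕ → V) → W where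
  toFun f x := f fun i => x i
  map_add' _ _ := rfl
  map_smul' _ _ := rfl

theorem evalSeq_apply {n : ℕ} (f : Cochain K V W n) (x : ℕ → V) :
    evalSeq f x = f fun i => x i := rfl

theorem evalSeq_congr {n : ℕ} (f : Cochain K V W n) {x y : ℕ → V} (h : ∀ k ≤ n, x k = y k) :
    evalSeq f x = evalSeq f y :=
  congrArg f (funext fun i => h i i.is_le)

theorem evalSeq_extend {n : ℕ} (f : Cochain K V W n) (x : Fin (n + 1) → V) :
    evalSeq f (Function.extend Fin.val x 0) = f x :=
  congrArg f (funext fun i => Fin.val_injective.extend_apply x 0 i)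

theorem evalSeq_injective {n : ℕ} :
    Function.Injective (evalSeq : Cochain K V W n →ₗ[K] (ℕ → V) → W) := by
  intro f g hfg
  ext x
  rw [← evalSeq_extend f, ← evalSeq_extend g, hfg]

theorem evalSeq_replaceBlock_sum {ι : Type*} {m : ℕ} (f : Cochain K V W m) (n : ℕ) {i : ℕ}
    (hi : i ≤ m) (s : Finset ι) (c : ι → K) (u : ι → V) (x : ℕ → V) :
    evalSeq f (replaceBlock i n (∑ a ∈ s, c a • u a) x) =
      ∑ a ∈ s, c a • evalSeq f (replaceBlock i n (u a) x) := by
  have eval_eq (v : V) : evalSeq f (replaceBlock i n v x) =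
      f (Function.update (fun j => if (j : ℕ) < i then x j else x (j + n)) ⟨i, by omega⟩ v) := by
    refine congrArg f (funext fun j => ?_)
    simp only [Function.update_apply, Fin.ext_iff, replaceBlock]
    split_ifs <;> first | rfl | omega
  simp only [eval_eq, MultilinearMap.map_update_sum, MultilinearMap.map_update_smul]

/-- The sequence `x₀, …, x_{i-1}, g(x_i, …, x_{i+n}), x_{i+n+1}, …`. -/
def insertSeq {n : ℕ} (g : Cochain K V V n) (i : ℕ) (x : ℕ → V) : ℕ → V :=
  replaceBlock i n (evalSeq g fun k => x (i + k)) x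

theorem evalSeq_insertAt {m n : ℕ} (f : Cochain K V V m) (g : Cochain K V V n) (i : Fin (m + 1))
    (x : ℕ → V) : evalSeq (insertAt f g i) x = evalSeq f (insertSeq g i x) := by
  refine congrArg f (funext fun j => ?_)
  simp only [insertArgs, insertSeq, replaceBlock, evalSeq_apply, Fin.lt_def, Fin.ext_iff]

theorem circ_apply {m n : ℕ} (f : Cochain K V V m) (g : Cochain K V V n) :
    circ m n f g = ∑ i : Fin (m + 1), (-1 : K) ^ ((i : ℕ) * n) • insertAt f g i := rfl

theorem evalSeq_circ {m n : ℕ} (f : Cochain K V V m) (g : Cochain K V V n) (x : ℕ → V) :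
    evalSeq (circ m n f g) x =
      ∑ i ∈ Finset.range (m + 1), (-1 : K) ^ (i * n) • evalSeq f (insertSeq g i x) := by
  rw [circ_apply, Finset.sum_range, map_sum, Finset.sum_apply]
  simp only [map_smul, Pi.smul_apply, evalSeq_insertAt]

theorem insertSeq_comm {p q : ℕ} (u : Cochain K V V p) (v : Cochain K V V q) {a b : ℕ}
    (hab : a < b) (x : ℕ → V) :
    insertSeq u a (insertSeq v (b + p) x) = insertSeq v b (insertSeq u a x) := by
  have hu : evalSeq u (fun k => insertSeq v (b + p) x (a + k)) = evalSeq u fun k => x (a + k) :=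
    evalSeq_congr u fun k hk => replaceBlock_of_lt _ _ _ (by omega)
  have hv : (fun k => insertSeq u a x (b + k)) = fun k => x (b + p + k) :=
    funext fun k => (replaceBlock_of_gt _ _ _ (by omega)).trans (congrArg x (by omega))
  rw [insertSeq, hu, insertSeq, replaceBlock_replaceBlock_comm _ _ hab, insertSeq, hv, insertSeq]

theorem evalSeq_insertSeq_circ {m n p : ℕ} (f : Cochain K V V m) (g : Cochain K V V n)
    (h : Cochain K V V p) {i : ℕ} (hi : i ≤ m) (x : ℕ → V) :
    evalSeq f (insertSeq (circ n p g h) i x) = ∑ k ∈ Finset.range (n + 1),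
      (-1 : K) ^ (k * p) • evalSeq f (insertSeq g i (insertSeq h (i + k) x)) := by
  rw [insertSeq, evalSeq_circ, evalSeq_replaceBlock_sum f _ hi]
  refine Finset.sum_congr rfl fun k hk => ?_
  have hk : k ≤ n := Nat.lt_succ_iff.mp (Finset.mem_range.mp hk)
  rw [insertSeq, insertSeq, insertSeq, replaceBlock_add,
    replaceBlock_replaceBlock_nested _ _ _ hk]
  simp only [add_assoc]

end Cochains

section GerstenhaberPreLie

variable {K : Type*} [Field K] {V W : Type*} [AddCommGroup V] [Module K V]
  [AddCommGroup W] [Module K W]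

/-- The sum of all `± f(…, u(…), …, v(…), …)` with `u` to the left of `v`, on the first terms of a
sequence; the associator of the composition product consists of two such sums. -/
def insertTwo {m p q : ℕ} (f : Cochain K V V m) (u : Cochain K V V p) (v : Cochain K V V q)
    (x : ℕ → V) : V :=
  ∑ b ∈ Finset.range (m + 1), ∑ a ∈ Finset.range b,
    (-1 : K) ^ (a * p + b * q) • evalSeq f (insertSeq v b (insertSeq u a x))

variable {m n p : ℕ} (f : Cochain K V V m) (g : Cochain K V V n) (h : Cochain K V V p) (x : ℕ → V)

theorem evalSeq_circ_circ_left :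
    evalSeq (circ (m + n) p (circ m n f g) h) x =
      ∑ i ∈ Finset.range (m + 1), ∑ j ∈ Finset.range (m + n + 1),
        (-1 : K) ^ (j * p + i * n) • evalSeq f (insertSeq g i (insertSeq h j x)) := by
  rw [evalSeq_circ, Finset.sum_comm]
  simp only [evalSeq_circ, Finset.smul_sum, smul_smul, pow_add]

theorem evalSeq_circ_circ_right :
    evalSeq (circ m (n + p) f (circ n p g h)) x =
      ∑ i ∈ Finset.range (m + 1), ∑ k ∈ Finset.range (n + 1),
        (-1 : K) ^ ((i + k) * p + i * n) •
          evalSeq f (insertSeq g i (insertSeq h (i + k) x)) := by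
  rw [evalSeq_circ]
  refine Finset.sum_congr rfl fun i hi => ?_
  rw [evalSeq_insertSeq_circ f g h (Finset.mem_range_succ_iff.mp hi), Finset.smul_sum]
  refine Finset.sum_congr rfl fun k _ => ?_
  rw [smul_smul, ← pow_add]
  ring_nf

theorem smul_insertTwo :
    (-1 : K) ^ (n * p) • insertTwo f g h x =
      ∑ i ∈ Finset.range (m + 1), ∑ b ∈ Finset.Ico (i + 1) (m + 1),
        (-1 : K) ^ ((b + n) * p + i * n) •
          evalSeq f (insertSeq g i (insertSeq h (b + n) x)) := by
  rw [insertTwo, Finset.smul_sum, Finset.sum_comm' (t' := Finset.range (m + 1))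
    (s' := fun b => Finset.range b) (by intro a b; simp; omega)]
  refine Finset.sum_congr rfl fun b _ => ?_
  rw [Finset.smul_sum]
  refine Finset.sum_congr rfl fun a ha => ?_
  rw [insertSeq_comm g h (Finset.mem_range.mp ha), smul_smul, ← pow_add]
  ring_nf

theorem evalSeq_circ_circ :
    evalSeq (circ (m + n) p (circ m n f g) h) x =
      evalSeq (circ m (n + p) f (circ n p g h)) x +
        (insertTwo f h g x + (-1 : K) ^ (n * p) • insertTwo f g h x) := by
  rw [evalSeq_circ_circ_left, evalSeq_circ_circ_right, smul_insertTwo, insertTwo,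
    ← Finset.sum_add_distrib, ← Finset.sum_add_distrib]
  refine Finset.sum_congr rfl fun i hi => ?_
  rw [sum_range_eq_sum_blocks n (Finset.mem_range_succ_iff.mp hi)]
  abel

variable (K V) in
/-- The composition product `∘` on `⨁_{n ≥ 0} Hom(⊗ⁿ⁺¹ V, V)`, the bilinear extension of `circ`;
the Gerstenhaber bracket is its graded commutator. -/
def circTotal : Cochains K V V →ₗ[K] Cochains K V V →ₗ[K] Cochains K V V :=
  DirectSum.toModule K ℕ _ fun m =>
    (DirectSum.toModule K ℕ _ fun n =>
      ((circ m n).compr₂ (DirectSum.lof K ℕ (Cochain K V V) (m + n))).flip).flip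

theorem circTotal_lof :
    circTotal K V (DirectSum.lof K ℕ (Cochain K V V) m f)
      (DirectSum.lof K ℕ (Cochain K V V) n g) =
        DirectSum.lof K ℕ (Cochain K V V) (m + n) (circ m n f g) := by
  simp [circTotal, DirectSum.toModule_lof]

theorem gerstenhaber_lof :
    gerstenhaber K V (DirectSum.lof K ℕ (Cochain K V V) m f)
      (DirectSum.lof K ℕ (Cochain K V V) n g) =
        DirectSum.lof K ℕ (Cochain K V V) (m + n) (circ m n f g) -
          (-1 : K) ^ (m * n) • DirectSum.lof K ℕ (Cochain K V V) (n + m) (circ n m g f) := by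
  simp [gerstenhaber, DirectSum.toModule_lof, bracketHom]

/-- `evalSeq` in all degrees at once. Its target is a direct sum of copies of one module, so that
there degrees can be rewritten. -/
def evalSeqs : Cochains K V W →ₗ[K] ⨁ _ : ℕ, ((ℕ → V) → W) :=
  DirectSum.lmap fun _ => evalSeq

theorem evalSeqs_lof (g : Cochain K V W n) :
    evalSeqs (DirectSum.lof K ℕ (Cochain K V W) n g) =
      DirectSum.lof K ℕ (fun _ => (ℕ → V) → W) n (evalSeq g) :=
  DirectSum.lmap_lof (M := Cochain K V W) (fun _ => evalSeq) n g

theorem evalSeqs_injective :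
    Function.Injective (evalSeqs : Cochains K V W →ₗ[K] ⨁ _ : ℕ, ((ℕ → V) → W)) :=
  (DirectSum.lmap_injective _).mpr fun _ => evalSeq_injective

theorem evalSeqs_associator :
    let f' := DirectSum.lof K ℕ (Cochain K V V) m f
    let g' := DirectSum.lof K ℕ (Cochain K V V) n g
    let h' := DirectSum.lof K ℕ (Cochain K V V) p h
    evalSeqs (circTotal K V (circTotal K V f' g') h' - circTotal K V f' (circTotal K V g' h')) =
      DirectSum.lof K ℕ (fun _ => (ℕ → V) → V) (m + n + p)
        (insertTwo f h g + (-1 : K) ^ (n * p) • insertTwo f g h) := by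
  intro f' g' h'
  rw [circTotal_lof, circTotal_lof, circTotal_lof, circTotal_lof, map_sub, evalSeqs_lof,
    evalSeqs_lof, show evalSeq (circ (m + n) p (circ m n f g) h) = _ from
      funext (evalSeq_circ_circ f g h)]
  generalize evalSeq (circ m (n + p) f (circ n p g h)) = u
  rw [← add_assoc m n p, ← map_sub]
  exact congrArg _ (add_sub_cancel_left u _)

theorem circTotal_associator :
    let f' := DirectSum.lof K ℕ (Cochain K V V) m f
    let g' := DirectSum.lof K ℕ (Cochain K V V) n g
    let h' := DirectSum.lof K ℕ (Cochain K V V) p h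
    circTotal K V (circTotal K V f' g') h' - circTotal K V f' (circTotal K V g' h') =
      (-1 : K) ^ (n * p) •
        (circTotal K V (circTotal K V f' h') g' - circTotal K V f' (circTotal K V h' g')) := by
  intro f' g' h'
  refine evalSeqs_injective ?_
  rw [map_smul, evalSeqs_associator, evalSeqs_associator, ← map_smul, add_right_comm m p n,
    smul_add, smul_smul, mul_comm p n, ← mul_pow, neg_one_mul, neg_neg, one_pow, one_smul,
    add_comm (insertTwo f h g)]

theorem lof_mem_cochainGrading (g : Cochain K V W n) :
    DirectSum.lof K ℕ (Cochain K V W) n g ∈ cochainGrading K V W n := ⟨g, rfl⟩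

theorem exists_lof_of_mem_cochainGrading {i : ℤ} {x : Cochains K V W}
    (hx : x ∈ cochainGrading K V W i) :
    x = 0 ∨ ∃ (n : ℕ) (f : Cochain K V W n), i = n ∧ x = DirectSum.lof K ℕ (Cochain K V W) n f := by
  cases i with
  | ofNat n => exact Or.inr ⟨n, hx.choose, rfl, hx.choose_spec.symm⟩
  | negSucc n => exact Or.inl ((Submodule.mem_bot K).mp hx)

variable (K V W) in
theorem cochainGrading_iSupIndep : iSupIndep (cochainGrading K V W) := by
  intro i
  cases i with
  | negSucc n => exact disjoint_bot_left
  | ofNat n =>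
    have others_le : (⨆ j, ⨆ (_ : j ≠ Int.ofNat n), cochainGrading K V W j) ≤
        LinearMap.ker (DirectSum.component K ℕ (Cochain K V W) n) := by
      refine iSup₂_le fun j hj x hx => ?_
      rcases exists_lof_of_mem_cochainGrading hx with rfl | ⟨k, f, rfl, rfl⟩
      · exact zero_mem _
      · rw [LinearMap.mem_ker, DirectSum.component.of, dif_neg]
        rintro rfl
        exact hj rfl
    rw [Submodule.disjoint_def]
    rintro x ⟨f, rfl⟩ hx
    have hf : f = 0 := by
      rw [← DirectSum.component.lof_self K n f]
      exact others_le hx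
    rw [hf, map_zero]

variable (K V W) in
theorem iSup_cochainGrading : ⨆ i, cochainGrading K V W i = ⊤ := by
  rw [eq_top_iff]
  rintro x -
  induction x using DirectSum.induction_on with
  | zero => exact zero_mem _
  | of n f => exact Submodule.mem_iSup_of_mem (n : ℤ) (lof_mem_cochainGrading f)
  | add x y hx hy => exact add_mem hx hy

variable (K V W) in
theorem cochainGrading_isInternal : DirectSum.IsInternal (cochainGrading K V W) :=
  (DirectSum.isInternal_submodule_iff_iSupIndep_and_iSup_eq_top _).mpr
    ⟨cochainGrading_iSupIndep K V W, iSup_cochainGrading K V W⟩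

theorem negOnePow_natCast_smul {M : Type*} [AddCommGroup M] [Module K M] (a : ℕ) (v : M) :
    (a : ℤ).negOnePow • v = (-1 : K) ^ a • v := by
  rcases Nat.even_or_odd a with ha | ha
  · rw [Int.negOnePow_even _ (by exact_mod_cast ha), ha.neg_one_pow, one_smul, one_smul]
  · rw [Int.negOnePow_odd _ (by exact_mod_cast ha), ha.neg_one_pow, neg_smul, one_smul,
      Units.neg_smul, one_smul]

variable (K V) in
theorem circTotal_isGradedPreLie : IsGradedPreLie (cochainGrading K V V) (circTotal K V) where
  degree i j x y hx hy := by
    rcases exists_lof_of_mem_cochainGrading hx with rfl | ⟨m, f, rfl, rfl⟩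
    · simp
    rcases exists_lof_of_mem_cochainGrading hy with rfl | ⟨n, g, rfl, rfl⟩
    · simp
    rw [circTotal_lof, ← Nat.cast_add]
    exact lof_mem_cochainGrading _
  associator i j k x y z hx hy hz := by
    rcases exists_lof_of_mem_cochainGrading hx with rfl | ⟨m, f, rfl, rfl⟩
    · simp
    rcases exists_lof_of_mem_cochainGrading hy with rfl | ⟨n, g, rfl, rfl⟩
    · simp
    rcases exists_lof_of_mem_cochainGrading hz with rfl | ⟨p, h, rfl, rfl⟩
    · simp
    rw [← Nat.cast_mul, negOnePow_natCast_smul (K := K), circTotal_associator]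

theorem gerstenhaber_eq_commutator {i j : ℤ} {x y : Cochains K V V}
    (hx : x ∈ cochainGrading K V V i) (hy : y ∈ cochainGrading K V V j) :
    gerstenhaber K V x y = circTotal K V x y - (i * j).negOnePow • circTotal K V y x := by
  rcases exists_lof_of_mem_cochainGrading hx with rfl | ⟨m, f, rfl, rfl⟩
  · simp
  rcases exists_lof_of_mem_cochainGrading hy with rfl | ⟨n, g, rfl, rfl⟩
  · simp
  rw [gerstenhaber_lof, circTotal_lof, circTotal_lof, ← Nat.cast_mul,
    negOnePow_natCast_smul (K := K)]

variable (K V) in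
theorem gerstenhaber_isGradedLieAlgebra :
    IsGradedLieAlgebra (cochainGrading K V V) (gerstenhaber K V) :=
  (circTotal_isGradedPreLie K V).isGradedLieAlgebra (cochainGrading_isInternal K V V)
    fun _ _ _ _ => gerstenhaber_eq_commutator

end GerstenhaberPreLie

section Weight

variable {K : Type*} [Field K] {V : Type*} [AddCommGroup V] [Module K V]
  {ι : Type*} [AddCommMonoid ι] {S : ι → Submodule K V} {d e : ι}

/-- A cochain has weight `d` with respect to a family `S` of subspaces if it maps
`S t₀ ⊗ ⋯ ⊗ S tₙ` to `S (t₀ + ⋯ + tₙ + d)`. -/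
def HasWeight (S : ι → Submodule K V) (d : ι) {n : ℕ} (f : Cochain K V V n) : Prop :=
  ∀ (t : Fin (n + 1) → ι) (x : Fin (n + 1) → V), (∀ k, x k ∈ S (t k)) → f x ∈ S (∑ k, t k + d)

theorem hasWeight_iff_evalSeq {n : ℕ} {f : Cochain K V V n} :
    HasWeight S d f ↔ ∀ (t : ℕ → ι) (x : ℕ → V), (∀ k ≤ n, x k ∈ S (t k)) →
      evalSeq f x ∈ S (∑ k ∈ Finset.range (n + 1), t k + d) := by
  constructor
  · intro hf t x hx
    rw [Finset.sum_range]
    exact hf _ _ fun k => hx k k.is_le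
  · intro hf t x hx
    have extend_mem (k : ℕ) (hk : k ≤ n) :
        Function.extend Fin.val x 0 k ∈ S (Function.extend Fin.val t 0 k) := by
      lift k to Fin (n + 1) using Nat.lt_succ_of_le hk
      simpa only [Fin.val_injective.extend_apply] using hx k
    simpa only [evalSeq_extend, Finset.sum_range, Fin.val_injective.extend_apply] using
      hf _ _ extend_mem

theorem HasWeight.insertAt {m n : ℕ} {f : Cochain K V V m} {g : Cochain K V V n}
    (hf : HasWeight S d f) (hg : HasWeight S e g) (i : Fin (m + 1)) :
    HasWeight S (d + e) (insertAt f g i) := by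
  rw [hasWeight_iff_evalSeq] at hf hg ⊢
  intro t x hx
  have value_mem := hg (fun k => t (i + k)) (fun k => x (i + k)) fun k hk => hx _ (by omega)
  have args_mem (k : ℕ) (hk : k ≤ m) : insertSeq g i x k ∈
      S (replaceBlock i n (∑ k ∈ Finset.range (n + 1), t (i + k) + e) t k) := by
    simp only [insertSeq, replaceBlock]
    split_ifs
    exacts [hx _ (by omega), value_mem, hx _ (by omega)]
  have hfg := hf _ _ args_mem
  rw [sum_range_replaceBlock n i.is_le] at hfg
  rw [evalSeq_insertAt, sum_range_eq_sum_blocks n i.is_le]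
  convert hfg using 2
  abel

/-- The span of the homogeneous cochains of weight `d`. -/
def weightSubmodule (S : ι → Submodule K V) (d : ι) : Submodule K (Cochains K V V) :=
  Submodule.span K {c | ∃ (n : ℕ) (f : Cochain K V V n), HasWeight S d f ∧
    c = DirectSum.lof K ℕ (Cochain K V V) n f}

theorem lof_mem_weightSubmodule {n : ℕ} {f : Cochain K V V n}
    (hf : HasWeight S d f) : DirectSum.lof K ℕ (Cochain K V V) n f ∈ weightSubmodule S d :=
  Submodule.subset_span ⟨n, f, hf, rfl⟩

theorem lof_circ_mem_weightSubmodule {m n : ℕ} {f : Cochain K V V m} {g : Cochain K V V n}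
    (hf : HasWeight S d f) (hg : HasWeight S e g) :
    DirectSum.lof K ℕ (Cochain K V V) (m + n) (circ m n f g) ∈ weightSubmodule S (d + e) := by
  rw [circ_apply, map_sum]
  refine sum_mem fun i _ => ?_
  rw [map_smul]
  exact Submodule.smul_mem _ _ (lof_mem_weightSubmodule (hf.insertAt hg i))

theorem gerstenhaber_mem_weightSubmodule {x y : Cochains K V V}
    (hx : x ∈ weightSubmodule S d) (hy : y ∈ weightSubmodule S e) :
    gerstenhaber K V x y ∈ weightSubmodule S (d + e) := by
  refine LinearMap.BilinMap.apply_apply_mem_of_mem_span _ _ _ _ ?_ _ _ hx hy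
  rintro _ ⟨m, f, hf, rfl⟩ _ ⟨n, g, hg, rfl⟩
  rw [gerstenhaber_lof]
  refine sub_mem (lof_circ_mem_weightSubmodule hf hg) (Submodule.smul_mem _ _ ?_)
  rw [add_comm d e]
  exact lof_circ_mem_weightSubmodule hg hf

theorem weightSubmodule_eq_iSup (S : ι → Submodule K V) (d : ι) :
    weightSubmodule S d = ⨆ i, weightSubmodule S d ⊓ cochainGrading K V V i := by
  refine le_antisymm (Submodule.span_le.mpr ?_) (iSup_le fun i => inf_le_left)
  rintro _ ⟨n, f, hf, rfl⟩
  exact Submodule.mem_iSup_of_mem (n : ℤ) ⟨lof_mem_weightSubmodule hf, lof_mem_cochainGrading f⟩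

end Weight

section Bilinear

variable {K : Type*} [Field K] {V : Type*} [AddCommGroup V] [Module K V]

/-- A bilinear map as a cochain with two arguments. -/
def bilinCochain : (V →ₗ[K] V →ₗ[K] V) →ₗ[K] Cochain K V V 1 where
  toFun b := MultilinearMap.mk' (fun x : Fin (1 + 1) → V => b (x 0) (x 1))
    (by
      intro x i a c
      fin_cases i <;> simp)
    (by
      intro x i a c
      fin_cases i <;> simp)
  map_add' _ _ := rfl
  map_smul' _ _ := rfl

theorem bilinCochain_apply (b : V →ₗ[K] V →ₗ[K] V) (x : Fin (1 + 1) → V) :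
    bilinCochain b x = b (x 0) (x 1) := rfl

theorem evalSeq_bilinCochain (b : V →ₗ[K] V →ₗ[K] V) (x : ℕ → V) :
    evalSeq (bilinCochain b) x = b (x 0) (x 1) := rfl

theorem ofBilin_eq_lof (b : V →ₗ[K] V →ₗ[K] V) :
    ofBilin b = DirectSum.lof K ℕ (Cochain K V V) 1 (bilinCochain b) := rfl

theorem ofBilin_add (b c : V →ₗ[K] V →ₗ[K] V) : ofBilin (b + c) = ofBilin b + ofBilin c := by
  simp only [ofBilin_eq_lof, map_add]

theorem ofBilin_eq_zero_iff (b : V →ₗ[K] V →ₗ[K] V) : ofBilin b = 0 ↔ b = 0 := by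
  rw [ofBilin_eq_lof, DirectSum.lof_eq_of, map_eq_zero_iff _ (DirectSum.of_injective 1)]
  constructor
  · intro hb
    ext x y
    exact congrArg (fun f : Cochain K V V 1 => f ![x, y]) hb
  · rintro rfl
    exact map_zero _

theorem ofBilin_mem_weightSubmodule {ι : Type*} [AddCommMonoid ι] {S : ι → Submodule K V} {d : ι}
    {b : V →ₗ[K] V →ₗ[K] V} (hb : ∀ s t x y, x ∈ S s → y ∈ S t → b x y ∈ S (s + t + d)) :
    ofBilin b ∈ weightSubmodule S d := by
  refine lof_mem_weightSubmodule (f := bilinCochain b) fun t x hx => ?_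
  rw [Fin.sum_univ_two]
  exact hb _ _ _ _ (hx 0) (hx 1)

/-- A linear map as a cochain of degree `0`. -/
def ofLin (e : V →ₗ[K] V) : Cochains K V V :=
  DirectSum.lof K ℕ (Cochain K V V) 0 (MultilinearMap.ofSubsingleton K V V (0 : Fin 1) e)

theorem evalSeq_circ_bilinCochain_ofSubsingleton (b : V →ₗ[K] V →ₗ[K] V) (e : V →ₗ[K] V)
    (x : ℕ → V) :
    evalSeq (circ 1 0 (bilinCochain b) (MultilinearMap.ofSubsingleton K V V (0 : Fin 1) e)) x =
      b (e (x 0)) (x 1) + b (x 0) (e (x 1)) := by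
  rw [evalSeq_circ, Finset.sum_range_succ, Finset.sum_range_one]
  simp [insertSeq, replaceBlock, evalSeq_apply, bilinCochain_apply]

theorem evalSeq_circ_ofSubsingleton_bilinCochain (b : V →ₗ[K] V →ₗ[K] V) (e : V →ₗ[K] V)
    (x : ℕ → V) :
    evalSeq (circ 0 1 (MultilinearMap.ofSubsingleton K V V (0 : Fin 1) e) (bilinCochain b)) x =
      e (b (x 0) (x 1)) := by
  rw [evalSeq_circ, Finset.sum_range_one]
  simp [insertSeq, replaceBlock, evalSeq_apply, bilinCochain_apply]

theorem gerstenhaber_ofBilin_ofLin (b : V →ₗ[K] V →ₗ[K] V) (e : V →ₗ[K] V) :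
    gerstenhaber K V (ofBilin b) (ofLin e) = ofBilin (b ∘ₗ e + b.compl₂ e - b.compr₂ e) := by
  refine evalSeqs_injective ?_
  rw [ofBilin_eq_lof, ofBilin_eq_lof, ofLin, gerstenhaber_lof, mul_zero, pow_zero, one_smul,
    map_sub, evalSeqs_lof, evalSeqs_lof, evalSeqs_lof,
    funext (evalSeq_circ_bilinCochain_ofSubsingleton b e),
    funext (evalSeq_circ_ofSubsingleton_bilinCochain b e), ← map_sub]
  rfl

theorem gerstenhaber_gerstenhaber_ofBilin_ofLin {e : V →ₗ[K] V} (he : e ∘ₗ e = 0)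
    (b : V →ₗ[K] V →ₗ[K] V) :
    gerstenhaber K V (gerstenhaber K V (ofBilin b) (ofLin e)) (ofLin e) =
      (2 : K) • ofBilin (b.compl₁₂ e e - (b ∘ₗ e + b.compl₂ e).compr₂ e) := by
  have he (x : V) : e (e x) = 0 := LinearMap.congr_fun he x
  rw [gerstenhaber_ofBilin_ofLin, gerstenhaber_ofBilin_ofLin, two_smul, ← ofBilin_add]
  congr 1
  ext x y
  simp only [LinearMap.add_apply, LinearMap.sub_apply, LinearMap.comp_apply,
    LinearMap.compl₂_apply, LinearMap.compr₂_apply, LinearMap.compl₁₂_apply, map_add, map_sub, he,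
    map_zero, LinearMap.zero_apply]
  abel

theorem gerstenhaber_ofBilin_self {b : V →ₗ[K] V →ₗ[K] V}
    (hb : ∀ x y z, b (b x y) z = b x (b y z)) : gerstenhaber K V (ofBilin b) (ofBilin b) = 0 := by
  have circ_self : circ 1 1 (bilinCochain b) (bilinCochain b) = 0 := by
    refine evalSeq_injective (funext fun x => ?_)
    rw [evalSeq_circ, Finset.sum_range_succ, Finset.sum_range_one]
    simp [evalSeq_bilinCochain, insertSeq, replaceBlock, hb]
  rw [ofBilin_eq_lof, gerstenhaber_lof, circ_self, map_zero, smul_zero, sub_zero]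

end Bilinear

section Splitting

variable {K : Type*} [Field K] {𝒜 : Type*} [NonUnitalRing 𝒜] [Module K 𝒜]
  {A A' : Submodule K 𝒜}

variable (A A') in
/-- The weight grading of `𝒜 = A ⊕ A'`: `A` has weight `0` and `A'` has weight `1`. -/
def splitting (t : ℤ) : Submodule K 𝒜 := if t = 0 then A else if t = 1 then A' else ⊥

theorem splitting_zero : splitting A A' 0 = A := rfl

theorem splitting_one : splitting A A' 1 = A' := rfl

theorem splitting_eq_bot {t : ℤ} (ht : 2 ≤ t) : splitting A A' t = ⊥ := by
  rw [splitting, if_neg (by omega), if_neg (by omega)]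

theorem splitting_le_right {t : ℤ} (ht : t ≠ 0) : splitting A A' t ≤ A' := by
  rw [splitting, if_neg ht]
  split_ifs
  exacts [le_rfl, bot_le]

theorem splitting_le_left {t : ℤ} (ht : t ≠ 1) : splitting A A' t ≤ A := by
  rw [splitting, if_neg ht]
  split_ifs
  exacts [le_rfl, bot_le]

section liftBilin

variable {X Y Z : Submodule K 𝒜} {p : 𝒜 →ₗ[K] X} {q : 𝒜 →ₗ[K] Y}

theorem liftBilin_mem_weightSubmodule {ι : Type*} [AddCommMonoid ι] {S : ι → Submodule K 𝒜}
    {a c d e : ι} (b : X →ₗ[K] Y →ₗ[K] Z) (hp : ∀ t ≠ a, S t ≤ LinearMap.ker p)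
    (hq : ∀ t ≠ c, S t ≤ LinearMap.ker q) (hZ : Z ≤ S e) (hd : a + c + d = e) :
    liftBilin p q b ∈ weightSubmodule S d := by
  refine ofBilin_mem_weightSubmodule fun s t x y hx hy => ?_
  change (b (p x) (q y) : 𝒜) ∈ _
  by_cases hs : s = a
  · by_cases ht : t = c
    · rw [hs, ht, hd]
      exact hZ (Subtype.property _)
    · rw [LinearMap.mem_ker.mp (hq t ht hy), map_zero, Submodule.coe_zero]
      exact zero_mem _
  · rw [LinearMap.mem_ker.mp (hp s hs hx), map_zero, LinearMap.zero_apply, Submodule.coe_zero]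
    exact zero_mem _

theorem liftBilin_add (b c : X →ₗ[K] Y →ₗ[K] Z) :
    liftBilin p q (b + c) = liftBilin p q b + liftBilin p q c := by
  simp only [liftBilin, ← ofBilin_add]
  rfl

theorem liftBilin_eq_zero_iff (hp : Function.Surjective p) (hq : Function.Surjective q)
    (b : X →ₗ[K] Y →ₗ[K] Z) : liftBilin p q b = 0 ↔ b = 0 := by
  rw [liftBilin, ofBilin_eq_zero_iff]
  constructor
  · intro hb
    ext x y
    obtain ⟨x, rfl⟩ := hp x
    obtain ⟨y, rfl⟩ := hq y
    exact LinearMap.congr_fun₂ hb x y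
  · rintro rfl
    rfl

end liftBilin

namespace IsQuasiTwilled

variable (h : IsQuasiTwilled A A')

theorem fst_add_snd (x : 𝒜) : (h.fst x : 𝒜) + h.snd x = x :=
  Submodule.projection_add_projection_eq_self h.isCompl x

theorem fst_coe (x : A) : h.fst x = x := Submodule.projectionOnto_apply_left h.isCompl x

theorem snd_coe (x : A') : h.snd x = x := Submodule.projectionOnto_apply_left h.isCompl.symm x

theorem fst_surjective : Function.Surjective h.fst := fun x => ⟨x, h.fst_coe x⟩

theorem ker_fst : LinearMap.ker h.fst = A' := Submodule.ker_projectionOnto h.isCompl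

theorem ker_snd : LinearMap.ker h.snd = A := Submodule.ker_projectionOnto h.isCompl.symm

theorem fst_coe_right (u : A') : h.fst (u : 𝒜) = 0 :=
  LinearMap.mem_ker.mp (h.ker_fst.ge u.2)

theorem splitting_le_ker_fst (t : ℤ) (ht : t ≠ 0) : splitting A A' t ≤ LinearMap.ker h.fst :=
  (splitting_le_right ht).trans h.ker_fst.ge

theorem splitting_le_ker_snd (t : ℤ) (ht : t ≠ 1) : splitting A A' t ≤ LinearMap.ker h.snd :=
  (splitting_le_left ht).trans h.ker_snd.ge

theorem cochain_ext (h : IsQuasiTwilled A A') {n : ℕ} {f g : Cochain K 𝒜 𝒜 n}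
    (hfg : ∀ (t : Fin (n + 1) → ℤ) (x : Fin (n + 1) → 𝒜), (∀ k, 0 ≤ t k) →
      (∀ k, x k ∈ splitting A A' (t k)) → f x = g x) : f = g := by
  ext x
  have hx : x = (fun k => (h.fst (x k) : 𝒜)) + fun k => (h.snd (x k) : 𝒜) :=
    funext fun k => (h.fst_add_snd (x k)).symm
  rw [hx, MultilinearMap.map_add_univ, MultilinearMap.map_add_univ]
  refine Finset.sum_congr rfl fun s _ => hfg (s.piecewise 0 1) _ (fun k => ?_) fun k => ?_
  · by_cases hk : k ∈ s <;> simp [hk]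
  · by_cases hk : k ∈ s <;> simp [hk, splitting_zero, splitting_one]

theorem eq_zero_of_mem_weightSubmodule (h : IsQuasiTwilled A A') {x : Cochains K 𝒜 𝒜} {d : ℤ}
    (hd : 2 ≤ d) (hx : x ∈ weightSubmodule (splitting A A') d) : x = 0 := by
  have weight_le_bot : weightSubmodule (splitting A A') d ≤ ⊥ := by
    refine Submodule.span_le.mpr ?_
    rintro _ ⟨n, f, hf, rfl⟩
    have f_eq_zero : f = 0 := h.cochain_ext fun t x ht hx => by
      have hfx := hf t x hx
      have sum_nonneg : 0 ≤ ∑ k, t k := Finset.sum_nonneg fun k _ => ht k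
      rwa [splitting_eq_bot (by omega), Submodule.mem_bot] at hfx
    rw [f_eq_zero, map_zero]
    exact zero_mem _
  exact weight_le_bot hx

theorem liftHom_apply {n : ℕ} (f : Cochain K A A' n) (x : Fin (n + 1) → 𝒜) :
    h.liftHom n f x = f fun k => h.fst (x k) := rfl

theorem componentHom_apply {n : ℕ} (f : Cochain K 𝒜 𝒜 n) (x : Fin (n + 1) → A) :
    h.componentHom n f x = h.snd (f fun k => (x k : 𝒜)) := rfl

theorem componentHom_liftHom {n : ℕ} (f : Cochain K A A' n) :
    h.componentHom n (h.liftHom n f) = f := by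
  ext x
  rw [componentHom_apply, liftHom_apply, snd_coe]
  simp only [fst_coe]

theorem componentHom_eq_zero_iff {n : ℕ} {f : Cochain K 𝒜 𝒜 n} :
    h.componentHom n f = 0 ↔ HasWeight (fun _ : Unit => A) 0 f := by
  constructor
  · intro hf t x hx
    rw [← h.ker_snd]
    exact congrArg (fun g : Cochain K A A' n => g fun k => ⟨x k, hx k⟩) hf
  · intro hf
    ext1 x
    exact LinearMap.mem_ker.mp (h.ker_snd.ge (hf 0 _ fun k => (x k).2))

theorem lift_lof {n : ℕ} (f : Cochain K A A' n) :
    h.lift (DirectSum.lof K ℕ (Cochain K A A') n f) =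
      DirectSum.lof K ℕ (Cochain K 𝒜 𝒜) n (h.liftHom n f) :=
  DirectSum.lmap_lof _ _ _

theorem P_lof {n : ℕ} (f : Cochain K 𝒜 𝒜 n) :
    h.P (DirectSum.lof K ℕ (Cochain K 𝒜 𝒜) n f) =
      DirectSum.lof K ℕ (Cochain K 𝒜 𝒜) n (h.liftHom n (h.componentHom n f)) := by
  rw [P, LinearMap.comp_apply, DirectSum.lmap_lof, lift_lof]

theorem leftInverse_lift : Function.LeftInverse (DirectSum.lmap h.componentHom) h.lift := by
  refine LinearMap.congr_fun (f := DirectSum.lmap h.componentHom ∘ₗ h.lift) (g := .id) ?_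
  ext1 n
  ext1 f
  simp only [LinearMap.comp_apply, lift_lof, DirectSum.lmap_lof, componentHom_liftHom,
    LinearMap.id_apply]

theorem lift_injective : Function.Injective h.lift := h.leftInverse_lift.injective

theorem P_comp_P : h.P ∘ₗ h.P = h.P :=
  LinearMap.ext fun _ => congrArg h.lift (h.leftInverse_lift _)

theorem range_P : LinearMap.range h.P = h.F :=
  LinearMap.range_comp_of_range_eq_top _
    (LinearMap.range_eq_top.mpr h.leftInverse_lift.surjective)

theorem liftHom_apply_eq_zero {n : ℕ} (f : Cochain K A A' n) {x : Fin (n + 1) → 𝒜}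
    (k : Fin (n + 1)) (hk : h.fst (x k) = 0) : h.liftHom n f x = 0 := by
  rw [liftHom_apply, MultilinearMap.map_coord_zero _ k hk, Submodule.coe_zero]

theorem hasWeight_liftHom {n : ℕ} (f : Cochain K A A' n) :
    HasWeight (splitting A A') 1 (h.liftHom n f) := by
  intro t x hx
  by_cases ht : ∀ k, t k = 0
  · rw [Fintype.sum_eq_zero _ ht, zero_add]
    exact Subtype.property _
  · push Not at ht
    obtain ⟨k, hk⟩ := ht
    rw [h.liftHom_apply_eq_zero f k (h.splitting_le_ker_fst _ hk (hx k))]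
    exact zero_mem _

theorem liftHom_componentHom_of_hasWeight {n : ℕ} {f : Cochain K 𝒜 𝒜 n}
    (hf : HasWeight (splitting A A') 1 f) : h.liftHom n (h.componentHom n f) = f := by
  refine h.cochain_ext fun t x t_nonneg hx => ?_
  have hfx := hf t x hx
  by_cases ht : ∀ k, t k = 0
  · have fst_eq_self : (fun k => (h.fst (x k) : 𝒜)) = x := funext fun k => by
      have hxk := hx k
      rw [ht k] at hxk
      exact congrArg Subtype.val (h.fst_coe ⟨x k, hxk⟩)
    rw [Fintype.sum_eq_zero _ ht, zero_add] at hfx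
    rw [liftHom_apply, componentHom_apply, fst_eq_self]
    exact congrArg Subtype.val (h.snd_coe ⟨f x, hfx⟩)
  · push Not at ht
    obtain ⟨k, hk⟩ := ht
    have sum_pos : 0 < ∑ k, t k :=
      Finset.sum_pos' (fun k _ => t_nonneg k) ⟨k, Finset.mem_univ k, (t_nonneg k).lt_of_ne' hk⟩
    rw [splitting_eq_bot (by omega), Submodule.mem_bot] at hfx
    rw [hfx, h.liftHom_apply_eq_zero _ k (h.splitting_le_ker_fst _ hk (hx k))]

theorem F_eq_weightSubmodule : h.F = weightSubmodule (splitting A A') 1 := by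
  refine le_antisymm ?_ (Submodule.span_le.mpr ?_)
  · rintro _ ⟨c, rfl⟩
    induction c using DirectSum.induction_on with
    | zero => simp only [map_zero, zero_mem]
    | of n f =>
      rw [← DirectSum.lof_eq_of K, lift_lof]
      exact lof_mem_weightSubmodule (h.hasWeight_liftHom f)
    | add x y hx hy =>
      rw [map_add]
      exact add_mem hx hy
  · rintro _ ⟨n, f, hf, rfl⟩
    rw [← h.liftHom_componentHom_of_hasWeight hf, ← lift_lof]
    exact ⟨_, rfl⟩

theorem P_eq_self {x : Cochains K 𝒜 𝒜} (hx : x ∈ weightSubmodule (splitting A A') 1) :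
    h.P x = x := by
  rw [← h.F_eq_weightSubmodule, ← h.range_P] at hx
  obtain ⟨y, rfl⟩ := hx
  exact LinearMap.congr_fun h.P_comp_P y

theorem P_eq_zero {x : Cochains K 𝒜 𝒜} {d : ℤ} (hd : d ≠ 1)
    (hx : x ∈ weightSubmodule (splitting A A') d) : h.P x = 0 := by
  have weight_le_ker : weightSubmodule (splitting A A') d ≤ LinearMap.ker h.P := by
    refine Submodule.span_le.mpr ?_
    rintro _ ⟨n, f, hf, rfl⟩
    have component_eq_zero : h.componentHom n f = 0 := h.componentHom_eq_zero_iff.mpr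
      fun _ x hx => splitting_le_left hd (by simpa using hf 0 x hx)
    rw [SetLike.mem_coe, LinearMap.mem_ker, P_lof, component_eq_zero, map_zero, map_zero]
  exact weight_le_ker hx

theorem gerstenhaber_mem_of_mem_F {d e : ℤ} {x f : Cochains K 𝒜 𝒜}
    (hx : x ∈ weightSubmodule (splitting A A') d) (hf : f ∈ h.F) (hd : d + 1 = e) :
    gerstenhaber K 𝒜 x f ∈ weightSubmodule (splitting A A') e :=
  hd ▸ gerstenhaber_mem_weightSubmodule hx (h.F_eq_weightSubmodule.le hf)

theorem gerstenhaber_eq_zero_of_mem_F {x f : Cochains K 𝒜 𝒜}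
    (hx : x ∈ weightSubmodule (splitting A A') 1) (hf : f ∈ h.F) : gerstenhaber K 𝒜 x f = 0 :=
  h.eq_zero_of_mem_weightSubmodule le_rfl (h.gerstenhaber_mem_of_mem_F hx hf one_add_one_eq_two)

theorem F_isGradedLieSubalgebra :
    IsGradedLieSubalgebra (cochainGrading K 𝒜 𝒜) (gerstenhaber K 𝒜) h.F where
  graded := by
    rw [F_eq_weightSubmodule]
    exact weightSubmodule_eq_iSup _ _
  closed x hx y hy := by
    rw [h.gerstenhaber_eq_zero_of_mem_F (h.F_eq_weightSubmodule.le hx) hy]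
    exact zero_mem _

-- With `A` alone, in a single weight, the cochains of weight `0` are those that preserve `A`.
theorem ker_P : LinearMap.ker h.P = weightSubmodule (fun _ : Unit => A) 0 := by
  classical
  refine le_antisymm (fun c hc => ?_) (Submodule.span_le.mpr ?_)
  · have component_eq_zero : DirectSum.lmap h.componentHom c = 0 :=
      h.lift_injective (hc.trans (map_zero h.lift).symm)
    rw [← DirectSum.sum_support_of c]
    refine sum_mem fun n _ => lof_mem_weightSubmodule (h.componentHom_eq_zero_iff.mp ?_)
    rw [← DirectSum.lmap_apply, component_eq_zero, DirectSum.zero_apply]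
  · rintro _ ⟨n, f, hf, rfl⟩
    rw [SetLike.mem_coe, LinearMap.mem_ker, P_lof, h.componentHom_eq_zero_iff.mpr hf, map_zero,
      map_zero]

theorem ker_P_isGradedLieSubalgebra :
    IsGradedLieSubalgebra (cochainGrading K 𝒜 𝒜) (gerstenhaber K 𝒜) (LinearMap.ker h.P) where
  graded := by
    rw [ker_P]
    exact weightSubmodule_eq_iSup _ _
  closed x hx y hy := by
    rw [ker_P] at hx hy ⊢
    exact gerstenhaber_mem_weightSubmodule hx hy

theorem coe_toF (D : A →ₗ[K] A') : (h.toF D : Cochains K 𝒜 𝒜) = ofLin (A'.subtype ∘ₗ D ∘ₗ h.fst) :=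
  (h.lift_lof _).trans
    (congrArg (DirectSum.lof K ℕ (Cochain K 𝒜 𝒜) 0) (MultilinearMap.ext fun _ => rfl))

theorem toF_mem_gradingF (D : A →ₗ[K] A') : h.toF D ∈ h.gradingF 0 := by
  rw [gradingF, inducedGrading, Submodule.mem_comap, Submodule.subtype_apply, coe_toF]
  exact lof_mem_cochainGrading _

theorem isCurvedVData [IsScalarTower K 𝒜 𝒜] [SMulCommClass K 𝒜 𝒜] :
    IsCurvedVData (cochainGrading K 𝒜 𝒜) (gerstenhaber K 𝒜) h.F h.P (mulCochain K 𝒜) where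
  gradedLie := gerstenhaber_isGradedLieAlgebra K 𝒜
  subalgebra := h.F_isGradedLieSubalgebra
  abelian _ hx _ hy := h.gerstenhaber_eq_zero_of_mem_F (h.F_eq_weightSubmodule.le hx) hy
  proj := h.P_comp_P
  range_proj := h.range_P
  ker_proj := h.ker_P_isGradedLieSubalgebra
  degree_one := lof_mem_cochainGrading (bilinCochain (LinearMap.mul K 𝒜))
  square_zero := gerstenhaber_ofBilin_self mul_assoc

end IsQuasiTwilled

end Splitting

section MaurerCartan

variable {K : Type*} [Field K] {L : Type*} [AddCommGroup L] [Module K L]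

theorem isMaurerCartan_iff_of_eq_zero {𝒢 : ℤ → Submodule K L}
    {l : (k : ℕ) → MultilinearMap K (fun _ : Fin k => L) L} {m : ℕ}
    (hl : ∀ k, m ≤ k → l k = 0) {x : L} :
    IsMaurerCartan 𝒢 l x ↔
      x ∈ 𝒢 0 ∧ ∑ k ∈ Finset.range m, (k.factorial : K)⁻¹ • l k (fun _ => x) = 0 := by
  have lt_of_ne_zero (k : ℕ) (hk : l k (fun _ => x) ≠ 0) : k < m := by
    by_contra! hmk
    exact hk (by rw [hl k hmk, zero_apply])
  have finsum_eq_sum_range : ∑ᶠ k : ℕ, ((k.factorial : K)⁻¹ • l k (fun _ => x)) =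
      ∑ k ∈ Finset.range m, (k.factorial : K)⁻¹ • l k (fun _ => x) :=
    finsum_eq_sum_of_support_subset _ fun k hk => by
      simpa using lt_of_ne_zero k (right_ne_zero_of_smul hk)
  rw [← finsum_eq_sum_range]
  exact ⟨fun H => ⟨H.degree_zero, H.sum_eq_zero⟩,
    fun H => ⟨H.1, (Set.finite_lt_nat m).subset lt_of_ne_zero, H.2⟩⟩

end MaurerCartan

section Multiplication

variable {K : Type*} [Field K] {𝒜 : Type*} [NonUnitalRing 𝒜] [Module K 𝒜]
  [IsScalarTower K 𝒜 𝒜] [SMulCommClass K 𝒜 𝒜] {A A' : Submodule K 𝒜}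

namespace IsQuasiTwilled

variable (h : IsQuasiTwilled A A')

theorem mulCochain_eq_sum : mulCochain K 𝒜 =
    h.hatπ + h.hatξ + h.hatη + h.hatβ + h.hatρ + h.hatμ + h.hatθ := by
  simp only [hatπ, hatξ, hatη, hatβ, hatρ, hatμ, hatθ, liftBilin, mulCochain, ← ofBilin_add]
  congr 1
  ext x y
  change x * y = (h.fst (h.fst x * h.fst y) : 𝒜) + h.fst (h.fst x * h.snd y) +
    h.fst (h.snd x * h.fst y) + h.snd (h.snd x * h.snd y) + h.snd (h.fst x * h.snd y) +
    h.snd (h.snd x * h.fst y) + h.snd (h.fst x * h.fst y)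
  have fst_mul_eq_zero : (h.fst (h.snd x * h.snd y) : 𝒜) = 0 :=
    congrArg Subtype.val (h.fst_coe_right ⟨_, h.mul_mem _ (h.snd x).2 _ (h.snd y).2⟩)
  conv_lhs => rw [← h.fst_add_snd x, ← h.fst_add_snd y, add_mul, mul_add, mul_add,
    ← h.fst_add_snd (h.fst x * h.fst y), ← h.fst_add_snd (h.fst x * h.snd y),
    ← h.fst_add_snd (h.snd x * h.fst y), ← h.fst_add_snd (h.snd x * h.snd y), fst_mul_eq_zero]
  abel

/-- The part `π + ρ + μ` of the multiplication, of weight `0`. -/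
def weightZeroPart : Cochains K 𝒜 𝒜 := h.hatπ + h.hatρ + h.hatμ

/-- The part `ξ + η + β` of the multiplication, of weight `-1`. -/
def weightNegOnePart : Cochains K 𝒜 𝒜 := h.hatξ + h.hatη + h.hatβ

theorem mulCochain_eq : mulCochain K 𝒜 = h.hatθ + h.weightZeroPart + h.weightNegOnePart := by
  rw [h.mulCochain_eq_sum, weightZeroPart, weightNegOnePart]
  abel

theorem hatθ_mem : h.hatθ ∈ weightSubmodule (splitting A A') 1 :=
  liftBilin_mem_weightSubmodule _ h.splitting_le_ker_fst h.splitting_le_ker_fst splitting_one.ge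
    (by norm_num)

theorem weightZeroPart_mem : h.weightZeroPart ∈ weightSubmodule (splitting A A') 0 := by
  refine add_mem (add_mem ?_ ?_) ?_
  · exact liftBilin_mem_weightSubmodule _ h.splitting_le_ker_fst h.splitting_le_ker_fst
      splitting_zero.ge (by norm_num)
  · exact liftBilin_mem_weightSubmodule _ h.splitting_le_ker_fst h.splitting_le_ker_snd
      splitting_one.ge (by norm_num)
  · exact liftBilin_mem_weightSubmodule _ h.splitting_le_ker_snd h.splitting_le_ker_fst
      splitting_one.ge (by norm_num)

theorem weightNegOnePart_mem : h.weightNegOnePart ∈ weightSubmodule (splitting A A') (-1) := by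
  refine add_mem (add_mem ?_ ?_) ?_
  · exact liftBilin_mem_weightSubmodule _ h.splitting_le_ker_fst h.splitting_le_ker_snd
      splitting_zero.ge (by norm_num)
  · exact liftBilin_mem_weightSubmodule _ h.splitting_le_ker_snd h.splitting_le_ker_fst
      splitting_zero.ge (by norm_num)
  · exact liftBilin_mem_weightSubmodule _ h.splitting_le_ker_snd h.splitting_le_ker_snd
      splitting_one.ge (by norm_num)

theorem P_mulCochain : h.P (mulCochain K 𝒜) = h.hatθ := by
  rw [h.mulCochain_eq, map_add, map_add, h.P_eq_self h.hatθ_mem,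
    h.P_eq_zero (by norm_num) h.weightZeroPart_mem,
    h.P_eq_zero (by norm_num) h.weightNegOnePart_mem, add_zero, add_zero]

section Brackets

variable {f g : Cochains K 𝒜 𝒜}

theorem gerstenhaber_weightZeroPart_mem (hf : f ∈ h.F) :
    gerstenhaber K 𝒜 h.weightZeroPart f ∈ weightSubmodule (splitting A A') 1 :=
  h.gerstenhaber_mem_of_mem_F h.weightZeroPart_mem hf (zero_add 1)

theorem gerstenhaber_weightNegOnePart_mem (hf : f ∈ h.F) :
    gerstenhaber K 𝒜 h.weightNegOnePart f ∈ weightSubmodule (splitting A A') 0 :=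
  h.gerstenhaber_mem_of_mem_F h.weightNegOnePart_mem hf (neg_add_cancel 1)

theorem gerstenhaber_gerstenhaber_weightNegOnePart_mem (hf : f ∈ h.F) (hg : g ∈ h.F) :
    gerstenhaber K 𝒜 (gerstenhaber K 𝒜 h.weightNegOnePart f) g ∈
      weightSubmodule (splitting A A') 1 :=
  h.gerstenhaber_mem_of_mem_F (h.gerstenhaber_weightNegOnePart_mem hf) hg (zero_add 1)

theorem gerstenhaber_mulCochain (hf : f ∈ h.F) :
    gerstenhaber K 𝒜 (mulCochain K 𝒜) f =
      gerstenhaber K 𝒜 h.weightZeroPart f + gerstenhaber K 𝒜 h.weightNegOnePart f := by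
  rw [h.mulCochain_eq, map_add, map_add, LinearMap.add_apply, LinearMap.add_apply,
    h.gerstenhaber_eq_zero_of_mem_F h.hatθ_mem hf, zero_add]

theorem P_gerstenhaber_mulCochain (hf : f ∈ h.F) :
    h.P (gerstenhaber K 𝒜 (mulCochain K 𝒜) f) = gerstenhaber K 𝒜 h.weightZeroPart f := by
  rw [h.gerstenhaber_mulCochain hf, map_add, h.P_eq_self (h.gerstenhaber_weightZeroPart_mem hf),
    h.P_eq_zero zero_ne_one (h.gerstenhaber_weightNegOnePart_mem hf), add_zero]

theorem gerstenhaber_gerstenhaber_mulCochain (hf : f ∈ h.F) (hg : g ∈ h.F) :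
    gerstenhaber K 𝒜 (gerstenhaber K 𝒜 (mulCochain K 𝒜) f) g =
      gerstenhaber K 𝒜 (gerstenhaber K 𝒜 h.weightNegOnePart f) g := by
  rw [h.gerstenhaber_mulCochain hf, map_add, LinearMap.add_apply,
    h.gerstenhaber_eq_zero_of_mem_F (h.gerstenhaber_weightZeroPart_mem hf) hg, zero_add]

end Brackets

theorem coe_l_zero (x : Fin 0 → h.F) : (h.l 0 x : Cochains K 𝒜 𝒜) = h.hatθ := h.P_mulCochain

theorem coe_l_one (x : Fin 1 → h.F) :
    (h.l 1 x : Cochains K 𝒜 𝒜) = gerstenhaber K 𝒜 h.weightZeroPart (x 0) :=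
  h.P_gerstenhaber_mulCochain (x 0).2

theorem coe_l_two (x : Fin 2 → h.F) :
    (h.l 2 x : Cochains K 𝒜 𝒜) =
      gerstenhaber K 𝒜 (gerstenhaber K 𝒜 h.weightNegOnePart (x 0)) (x 1) :=
  (congrArg h.P (h.gerstenhaber_gerstenhaber_mulCochain (x 0).2 (x 1).2)).trans
    (h.P_eq_self (h.gerstenhaber_gerstenhaber_weightNegOnePart_mem (x 0).2 (x 1).2))

theorem l_eq_zero (k : ℕ) (hk : 3 ≤ k) : h.l k = 0 :=
  derivedBracket_eq_zero _ (fun x hx => by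
    change gerstenhaber K 𝒜
      (gerstenhaber K 𝒜 (gerstenhaber K 𝒜 (mulCochain K 𝒜) (x 0)) (x 1)) (x 2) = 0
    rw [h.gerstenhaber_gerstenhaber_mulCochain (hx 0) (hx 1)]
    exact h.gerstenhaber_eq_zero_of_mem_F
      (h.gerstenhaber_gerstenhaber_weightNegOnePart_mem (hx 0) (hx 1)) (hx 2)) hk

theorem isCurvedLInfinity (hK : (2 : K) ≠ 0) : IsCurvedLInfinity (L := h.F) h.gradingF h.l :=
  h.isCurvedVData.isCurvedLInfinity hK _

section Deformation

variable (D : A →ₗ[K] A')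

/-- The difference of the two sides of the equation of a right deformation map. -/
def deformationDefect : A →ₗ[K] A →ₗ[K] A' :=
  h.mapρ.compl₂ D + h.mapμ ∘ₗ D + h.mapβ.compl₁₂ D D + h.mapθ -
    (h.mapπ + h.mapξ.compl₂ D + h.mapη ∘ₗ D).compr₂ D

theorem isRightDeformationMap_iff_deformationDefect_eq_zero :
    h.IsRightDeformationMap D ↔ h.deformationDefect D = 0 := by
  rw [LinearMap.ext_iff₂]
  exact forall₂_congr fun x y => eq_comm.trans sub_eq_zero.symm

theorem gerstenhaber_weightZeroPart_toF :
    gerstenhaber K 𝒜 h.weightZeroPart (h.toF D) = liftBilin h.fst h.fst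
      (h.mapρ.compl₂ D + h.mapμ ∘ₗ D - h.mapπ.compr₂ D) := by
  simp only [coe_toF, weightZeroPart, hatπ, hatρ, hatμ, liftBilin, ← ofBilin_add,
    gerstenhaber_ofBilin_ofLin]
  congr 1
  ext x y
  simp only [LinearMap.sub_apply, LinearMap.add_apply, LinearMap.comp_apply,
    LinearMap.compr₂_apply, LinearMap.compl₁₂_apply, LinearMap.compl₂_apply,
    Submodule.subtype_apply, h.fst_coe, h.snd_coe, h.fst_coe_right, map_add, map_zero,
    LinearMap.zero_apply, Submodule.coe_add, Submodule.coe_sub]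
  abel

theorem gerstenhaber_gerstenhaber_weightNegOnePart_toF :
    gerstenhaber K 𝒜 (gerstenhaber K 𝒜 h.weightNegOnePart (h.toF D)) (h.toF D) =
      (2 : K) • liftBilin h.fst h.fst
        (h.mapβ.compl₁₂ D D - (h.mapξ.compl₂ D + h.mapη ∘ₗ D).compr₂ D) := by
  have square_eq_zero :
      (A'.subtype ∘ₗ D ∘ₗ h.fst) ∘ₗ (A'.subtype ∘ₗ D ∘ₗ h.fst) = 0 := by
    ext x
    simp [h.fst_coe_right]
  simp only [coe_toF, weightNegOnePart, hatξ, hatη, hatβ, liftBilin, ← ofBilin_add,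
    gerstenhaber_gerstenhaber_ofBilin_ofLin square_eq_zero]
  congr 2
  ext x y
  simp [h.fst_coe, h.snd_coe, h.fst_coe_right, add_comm]

theorem maurerCartan_series_eq (hK : (2 : K) ≠ 0) :
    ((∑ k ∈ Finset.range 3, (k.factorial : K)⁻¹ • h.l k (fun _ => h.toF D) : h.F) :
      Cochains K 𝒜 𝒜) = liftBilin h.fst h.fst (h.deformationDefect D) := by
  simp only [Finset.sum_range_succ, Finset.range_zero, Finset.sum_empty, zero_add,
    Nat.factorial_zero, Nat.factorial_one, Nat.factorial_two, Nat.cast_one, Nat.cast_ofNat,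
    inv_one, one_smul, Submodule.coe_add, Submodule.coe_smul, coe_l_zero, coe_l_one, coe_l_two,
    gerstenhaber_weightZeroPart_toF, gerstenhaber_gerstenhaber_weightNegOnePart_toF,
    inv_smul_smul₀ hK, hatθ, ← liftBilin_add]
  congr 1
  ext x y
  simp only [deformationDefect, LinearMap.add_apply, LinearMap.sub_apply, LinearMap.comp_apply,
    LinearMap.compl₂_apply, LinearMap.compr₂_apply, LinearMap.compl₁₂_apply, map_add,
    Submodule.coe_add, Submodule.coe_sub]
  abel

theorem isRightDeformationMap_iff (hK : (2 : K) ≠ 0) :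
    h.IsRightDeformationMap D ↔ IsMaurerCartan (L := h.F) h.gradingF h.l (h.toF D) := by
  rw [isMaurerCartan_iff_of_eq_zero h.l_eq_zero, and_iff_right (h.toF_mem_gradingF D),
    ← Submodule.coe_eq_zero, h.maurerCartan_series_eq D hK,
    liftBilin_eq_zero_iff h.fst_surjective h.fst_surjective,
    isRightDeformationMap_iff_deformationDefect_eq_zero]

end Deformation

end IsQuasiTwilled

end Multiplication

end QuasiTwilled

end

open QuasiTwilled in
theorem theorem3 {K : Type*} [Field K] (hK : (2 : K) ≠ 0)
    {𝒜 : Type*} [NonUnitalRing 𝒜] [Module K 𝒜] [IsScalarTower K 𝒜 𝒜] [SMulCommClass K 𝒜 𝒜]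
    {A A' : Submodule K 𝒜} (h : IsQuasiTwilled A A') :
    -- the multiplication is the sum of its seven components
    mulCochain K 𝒜 = h.hatπ + h.hatξ + h.hatη + h.hatβ + h.hatρ + h.hatμ + h.hatθ ∧
    -- `⨁ Hom(⊗ⁿ⁺¹ A, A')` is embedded by the lift, with image `F`
    Function.Injective h.lift ∧
    -- the curved V-data
    IsCurvedVData (cochainGrading K 𝒜 𝒜) (gerstenhaber K 𝒜) h.F h.P (mulCochain K 𝒜) ∧
    -- the curved `L∞`-algebra
    IsCurvedLInfinity (L := h.F) h.gradingF h.l ∧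
    (h.l 0 ![] : Cochains K 𝒜 𝒜) = h.hatθ ∧
    (∀ f : h.F, (h.l 1 ![f] : Cochains K 𝒜 𝒜) =
      gerstenhaber K 𝒜 (h.hatπ + h.hatρ + h.hatμ) f) ∧
    (∀ f g : h.F, (h.l 2 ![f, g] : Cochains K 𝒜 𝒜) =
      gerstenhaber K 𝒜 (gerstenhaber K 𝒜 (h.hatξ + h.hatη + h.hatβ) f) g) ∧
    (∀ k : ℕ, 3 ≤ k → h.l k = 0) ∧
    -- right deformation maps are the Maurer–Cartan elements
    (∀ D : A →ₗ[K] A', h.IsRightDeformationMap D ↔ IsMaurerCartan (L := h.F) h.gradingF h.l (h.toF D)) :=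
  ⟨h.mulCochain_eq_sum, h.lift_injective, h.isCurvedVData, h.isCurvedLInfinity hK,
    h.coe_l_zero _, fun f => h.coe_l_one ![f], fun f g => h.coe_l_two ![f, g], h.l_eq_zero,
    fun D => h.isRightDeformationMap_iff D hK⟩
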